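/- **Conventions.** On $\mathbb{C}^{2m}$ with coordinates $(z^1,\dots,z^m,w_1,\dots,w_m)$ let $\Omega=\sum_i dz^i\wedge dw_i$, let $\tau$ be complex conjugation, and let $\gamma=\sqrt{-1}\,\Omega(\cdot,\tau\cdot)$. An *affine special Kähler structure* on a smooth manifold is a triple $(J,g,\nabla)$, where $(J,g)$ is a pseudo-Kähler structure of arbitrary signature with $\omega:=g(\cdot,J\cdot)$, and $\nabla$ is a flat torsion-free connection with $\nabla\omega=0$ and $d^\nabla J=0$. It is *conical* with respect to a vector field $\xi$ if $g(\xi,\xi)\neq 0$ everywhere and $\nabla\xi=D\xi=\mathrm{Id}$, where $D$ is the Levi-Civita connection of $g$. A holomorphic immersion $\phi:M\to\mathbb{C}^{2m}$ of a complex manifold of complex dimension $m$ is *Lagrangian* if $\phi^*\Omega=0$ and *Kählerian* if $\phi^*\gamma$ is non-degenerate. A Kählerian Lagrangian immersion *induces* $(J,g,\nabla)$ if $J$ is the complex structure of $M$, $g=\mathrm{Re}\,\phi^*\gamma$, and the real parts of the components of $\phi$ are $\nabla$-affine functions. A *special Kähler pair* $(\phi,F)$ of an affine special Kähler manifold $(M,J,g,\nabla)$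 of complex dimension $n$ consists of a Kählerian Lagrangian immersion $\phi=(z,w):M\to\mathbb{C}^{2n}$ inducing $(J,g,\nabla)$ and a function $F:M\to\mathbb{C}$ with $dF=\sum_i w_i\,dz^i$. Its *conification* is the map $$\Phi:\hat M:=\mathbb{C}^*\times M\to\mathbb{C}^{2n+2},\qquad \Phi(z^0,p)=z^0\bigl(1,\,(2F-z^tw)(p),\,\phi(p)\bigr),$$ where $\mathbb{C}^{2n+2}=\mathbb{C}^2\times\mathbb{C}^{2n}$ has coordinates $(z^0,w_0)$ on the first factor and symplectic form $\hat\Omega=dz^0\wedge dw_0+\Omega$, and $\hat\gamma=\sqrt{-1}\,\hat\Omega(\cdot,\tau\cdot)$. The pair is *non-degenerate* if $\Phi$ is Kählerian and $\hat\gamma(\Phi,\Phi)$ vanishes nowhere on $\hat M$. Let $G=\mathrm{Sp}(\mathbb{R}^{2n})\ltimes\mathrm{Heis}_{2n+1}(\mathbb{R})$ be the group of triples $x=(X,s,v)$ with $X\in\mathrm{Sp}(\mathbb{R}^{2n})$, $s\in\mathbb{R}$, $v\in\mathbb{R}^{2n}$ and product $(X,s,v)(X',s',v')=(XX',\,s+s'+\tfrac12\Omega(v,Xv'),\,Xv'+v)$.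 It acts on pairs by $x\cdot(\phi,F)=(\phi',F')$, where, with $\phi'=(z',w')$, $$\phi'=X\phi+v,\qquad F'=F-\tfrac12z^tw+\tfrac12z'^tw'+\tfrac12\Omega(\phi',v)-s .$$ **Theorem.** Let $(\phi,F)$ be a non-degenerate special Kähler pair of an affine special Kähler manifold $M$ of complex dimension $n$. Then $\Phi$ is a Kählerian Lagrangian immersion of $\hat M=\mathbb{C}^*\times M$ with its product complex structure, and it induces on $\hat M$ an affine special Kähler structure $(\hat J,\hat g,\hat\nabla)$ which is conical with respect to the vector field $\xi$ generating the action $e^t\cdot(z^0,p)=(e^tz^0,p)$ of $\mathbb{R}^{>0}\subset\mathbb{C}^*$. The structure $(\hat J,\hat g,\hat\nabla,\xi)$ is uniquely determined by $(\phi,F)$ and depends only on its $G$-orbit: every $(\phi',F')\in G\cdot(\phi,F)$ is again a non-degenerate special Kähler pair of $M$, and its conification induces the same conical affine special Kähler structure on $\hat M$. -/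

import Mathlib

open scoped Manifold ContDiff Bundle

noncomputable section

/-! ## Linear algebra of `ℂ^{2m}` -/

/-- The space `ℂ^{2m}` with coordinates `(z^1, …, z^m, w_1, …, w_m)`:
`Sum.inl i` is the index of `z^i` and `Sum.inr i` is the index of `w_i`. -/
abbrev CSymp (m : ℕ) : Type := Fin m ⊕ Fin m → ℂ

/-- The standard symplectic form `Ω = ∑ dz^i ∧ dw_i`, over any commutative ring. -/
def sympForm {R : Type*} [CommRing R] {m : ℕ} (u v : Fin m ⊕ Fin m → R) : R :=
  ∑ i : Fin m, (u (Sum.inl i) * v (Sum.inr i) - u (Sum.inr i) * v (Sum.inl i))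

/-- The Hermitian form `γ(u, v) = √-1 Ω(u, τ v)`, where `τ` is complex conjugation. -/
def hermForm {m : ℕ} (u v : CSymp m) : ℂ :=
  Complex.I * sympForm u (fun j => (starRingEnd ℂ) (v j))

/-- The number `zᵗ w = ∑ z^i w_i` attached to a vector `(z, w)`. -/
def pairingZW {m : ℕ} (u : CSymp m) : ℂ := ∑ i : Fin m, u (Sum.inl i) * u (Sum.inr i)

/-- The inclusion `ℝ^{2m} ⊂ ℂ^{2m}`. -/
def complexifyVec {m : ℕ} (v : Fin m ⊕ Fin m → ℝ) : CSymp m := fun j => (v j : ℂ)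

/-- A real `2m × 2m` matrix regarded as a complex matrix. -/
def complexifyMat {m : ℕ} (X : Matrix (Fin m ⊕ Fin m) (Fin m ⊕ Fin m) ℝ) :
    Matrix (Fin m ⊕ Fin m) (Fin m ⊕ Fin m) ℂ :=
  X.map Complex.ofRealHom

section Algebra

variable {m : ℕ} {R : Type*} [CommRing R]

theorem sympForm_eq_dotProduct (u v : Fin m ⊕ Fin m → R) :
    sympForm u v = - (u ⬝ᵥ (Matrix.J (Fin m) R).mulVec v) := by
  simp [sympForm, Matrix.J, dotProduct, Matrix.fromBlocks_mulVec, Fintype.sum_sum_type,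
    Finset.sum_sub_distrib, Matrix.neg_mulVec]
  ring

theorem sympForm_mulVec {X : Matrix (Fin m ⊕ Fin m) (Fin m ⊕ Fin m) R}
    (hX : X ∈ Matrix.symplecticGroup (Fin m) R) (u v : Fin m ⊕ Fin m → R) :
    sympForm (X.mulVec u) (X.mulVec v) = sympForm u v := by
  have h := SymplecticGroup.mem_iff'.1 hX
  have h1 : X.mulVec u ⬝ᵥ (Matrix.J (Fin m) R).mulVec (X.mulVec v)
      = u ⬝ᵥ (X.transpose * Matrix.J (Fin m) R * X).mulVec v := by
    rw [← Matrix.mulVec_mulVec, ← Matrix.mulVec_mulVec, Matrix.dotProduct_mulVec u,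
      Matrix.vecMul_transpose]
  rw [sympForm_eq_dotProduct, sympForm_eq_dotProduct, h1, h]

theorem sympForm_add_left (u u' v : Fin m ⊕ Fin m → R) :
    sympForm (u + u') v = sympForm u v + sympForm u' v := by
  simp only [sympForm, ← Finset.sum_add_distrib, Pi.add_apply]
  exact Finset.sum_congr rfl fun i _ => by ring

theorem sympForm_add_right (u v v' : Fin m ⊕ Fin m → R) :
    sympForm u (v + v') = sympForm u v + sympForm u v' := by
  simp only [sympForm, ← Finset.sum_add_distrib, Pi.add_apply]
  exact Finset.sum_congr rfl fun i _ => by ring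

theorem sympForm_self (u : Fin m ⊕ Fin m → R) : sympForm u u = 0 :=
  Finset.sum_eq_zero fun i _ => by ring

theorem sympForm_neg_right (u v : Fin m ⊕ Fin m → R) : sympForm u (-v) = - sympForm u v := by
  simp only [sympForm, ← Finset.sum_neg_distrib, Pi.neg_apply]
  exact Finset.sum_congr rfl fun i _ => by ring

theorem sympForm_zero_left (v : Fin m ⊕ Fin m → R) : sympForm 0 v = 0 := by
  simp [sympForm]

theorem sympForm_zero_right (v : Fin m ⊕ Fin m → R) : sympForm v 0 = 0 := by
  simp [sympForm]

theorem sympForm_complexifyVec (u v : Fin m ⊕ Fin m → ℝ) :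
    sympForm (complexifyVec u) (complexifyVec v) = ((sympForm u v : ℝ) : ℂ) := by
  simp [sympForm, complexifyVec]

theorem complexifyVec_add (u v : Fin m ⊕ Fin m → ℝ) :
    complexifyVec (u + v) = complexifyVec u + complexifyVec v := by
  ext j
  simp [complexifyVec]

theorem complexifyVec_mulVec (X : Matrix (Fin m ⊕ Fin m) (Fin m ⊕ Fin m) ℝ)
    (v : Fin m ⊕ Fin m → ℝ) :
    complexifyVec (X.mulVec v) = (complexifyMat X).mulVec (complexifyVec v) := by
  ext j
  simp [complexifyVec, complexifyMat, Matrix.mulVec, dotProduct]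

theorem complexifyMat_mem {X : Matrix (Fin m ⊕ Fin m) (Fin m ⊕ Fin m) ℝ}
    (hX : X ∈ Matrix.symplecticGroup (Fin m) ℝ) :
    complexifyMat X ∈ Matrix.symplecticGroup (Fin m) ℂ := by
  have h := congrArg (fun A => A.map Complex.ofRealHom) (SymplecticGroup.mem_iff.1 hX)
  simp only [Matrix.map_mul, Matrix.map_J, Matrix.transpose_map] at h
  exact SymplecticGroup.mem_iff.2 h

end Algebra

/-! ## The group `G = Sp(ℝ^{2n}) ⋉ Heis_{2n+1}(ℝ)` -/

/-- Elements `(X, s, v)` of `G = Sp(ℝ^{2n}) ⋉ Heis_{2n+1}(ℝ)`. -/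
@[ext]
structure SpHeis (n : ℕ) where
  /-- the linear part -/
  X : Matrix.symplecticGroup (Fin n) ℝ
  /-- the central part -/
  s : ℝ
  /-- the translation part -/
  v : Fin n ⊕ Fin n → ℝ

namespace SpHeis

variable {n : ℕ}

/-- `(X, s, v) (X', s', v') = (X X', s + s' + ½ Ω(v, X v'), X v' + v)`. -/
instance : Mul (SpHeis n) where
  mul x y := ⟨x.X * y.X, x.s + y.s + 1 / 2 * sympForm x.v (x.X.1.mulVec y.v),
    x.X.1.mulVec y.v + x.v⟩

instance : One (SpHeis n) where
  one := ⟨1, 0, 0⟩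

instance : Inv (SpHeis n) where
  inv x := ⟨x.X⁻¹, -x.s, -((x.X⁻¹).1.mulVec x.v)⟩

theorem mul_def (x y : SpHeis n) :
    x * y = ⟨x.X * y.X, x.s + y.s + 1 / 2 * sympForm x.v (x.X.1.mulVec y.v),
      x.X.1.mulVec y.v + x.v⟩ := rfl

theorem one_def : (1 : SpHeis n) = ⟨1, 0, 0⟩ := rfl

theorem inv_def (x : SpHeis n) :
    x⁻¹ = ⟨x.X⁻¹, -x.s, -((x.X⁻¹).1.mulVec x.v)⟩ := rfl

instance : Group (SpHeis n) := Group.ofLeftAxioms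
  (by
    intro x y z
    have h := sympForm_mulVec x.X.2 y.v (y.X.1.mulVec z.v)
    simp only [mul_def, SpHeis.mk.injEq]
    refine ⟨mul_assoc _ _ _, ?_, ?_⟩
    · simp only [Submonoid.coe_mul, ← Matrix.mulVec_mulVec, Matrix.mulVec_add,
        sympForm_add_left, sympForm_add_right] at h ⊢
      rw [h]
      ring
    · simp only [Submonoid.coe_mul, ← Matrix.mulVec_mulVec, Matrix.mulVec_add]
      abel)
  (by
    intro x
    simp [mul_def, one_def, sympForm_zero_left])
  (by
    intro x
    simp only [mul_def, inv_def, one_def, SpHeis.mk.injEq]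
    refine ⟨inv_mul_cancel _, ?_, by simp⟩
    have h := sympForm_neg_right (-((x.X⁻¹).1.mulVec x.v)) (-((x.X⁻¹).1.mulVec x.v))
    rw [sympForm_self, neg_neg, neg_zero] at h
    rw [h]
    ring)

end SpHeis

/-- Pairs `(φ, F)` of maps `φ : M → ℂ^{2n}` and `F : M → ℂ`. -/
@[ext]
structure ImmersionPair (M : Type*) (n : ℕ) where
  /-- the map `φ = (z, w)` -/
  φ : M → CSymp n
  /-- the function `F` -/
  F : M → ℂ

namespace ImmersionPair

variable {M : Type*} {n : ℕ}

/-- The affine transformation `q ↦ X q + v` of `ℂ^{2n}` given by `x = (X, s, v)`. -/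
def affineAct (x : SpHeis n) (q : CSymp n) : CSymp n :=
  (complexifyMat x.X.1).mulVec q + complexifyVec x.v

/-- The action `x · (φ, F) = (x φ, x · F)` with
`x · F = F - ½ zᵗ w + ½ z'ᵗ w' + ½ Ω(x φ, v) - s`, where `(z', w') = x φ`. -/
instance : SMul (SpHeis n) (ImmersionPair M n) where
  smul x p :=
    { φ := fun y => affineAct x (p.φ y)
      F := fun y => p.F y - 1 / 2 * pairingZW (p.φ y) + 1 / 2 * pairingZW (affineAct x (p.φ y))
        + 1 / 2 * sympForm (affineAct x (p.φ y)) (complexifyVec x.v) - (x.s : ℂ) }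

theorem smul_def (x : SpHeis n) (p : ImmersionPair M n) :
    x • p =
    { φ := fun y => affineAct x (p.φ y)
      F := fun y => p.F y - 1 / 2 * pairingZW (p.φ y) + 1 / 2 * pairingZW (affineAct x (p.φ y))
        + 1 / 2 * sympForm (affineAct x (p.φ y)) (complexifyVec x.v) - (x.s : ℂ) } := rfl

theorem affineAct_mul (x y : SpHeis n) (q : CSymp n) :
    affineAct (x * y) q = affineAct x (affineAct y q) := by
  simp only [affineAct, SpHeis.mul_def, complexifyVec_add, complexifyVec_mulVec,
    Matrix.mulVec_add, Matrix.mulVec_mulVec, Submonoid.coe_mul]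
  simp only [complexifyMat, Matrix.map_mul, add_assoc]

theorem affineAct_one (q : CSymp n) : affineAct 1 q = q := by
  ext j
  simp [affineAct, SpHeis.one_def, complexifyMat, complexifyVec]

instance : MulAction (SpHeis n) (ImmersionPair M n) where
  one_smul p := by
    have h0 : complexifyVec (1 : SpHeis n).v = 0 := by
      ext j
      simp [SpHeis.one_def, complexifyVec]
    have h1 : (1 : SpHeis n).s = 0 := rfl
    ext y
    · simp [smul_def, affineAct_one]
    · simp only [smul_def, affineAct_one, h0, h1, sympForm_zero_right]
      simp
  mul_smul x y p := by
    ext a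
    · simp [smul_def, affineAct_mul]
    · have h1 : sympForm (affineAct x (affineAct y (p.φ a)))
          ((complexifyMat x.X.1).mulVec (complexifyVec y.v))
          = sympForm (affineAct y (p.φ a)) (complexifyVec y.v)
            + sympForm (complexifyVec x.v) ((complexifyMat x.X.1).mulVec (complexifyVec y.v)) := by
        conv_lhs => rw [affineAct]
        rw [sympForm_add_left, sympForm_mulVec (complexifyMat_mem x.X.2)]
      have h2 : (((x * y).s : ℝ) : ℂ) = x.s + y.s
          + 1 / 2 * sympForm (complexifyVec x.v)
              ((complexifyMat x.X.1).mulVec (complexifyVec y.v)) := by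
        rw [← complexifyVec_mulVec, sympForm_complexifyVec]
        simp [SpHeis.mul_def]
      have h3 : complexifyVec (x * y).v
          = (complexifyMat x.X.1).mulVec (complexifyVec y.v) + complexifyVec x.v := by
        rw [← complexifyVec_mulVec, ← complexifyVec_add]
        rfl
      simp only [smul_def, affineAct_mul, h2, h3, sympForm_add_right, h1]
      ring

end ImmersionPair

/-! ## Affine special Kähler manifolds -/

section Geometry

variable {E : Type*} [NormedAddCommGroup E] [NormedSpace ℝ E] [FiniteDimensional ℝ E]
  {H : Type*} [TopologicalSpace H] (I : ModelWithCorners ℝ E H)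
  (M : Type*) [TopologicalSpace M] [ChartedSpace H M] [IsManifold I ∞ M]

/-- Smooth vector fields. -/
abbrev SmoothVectorField : Type _ :=
  Cₛ^∞⟮I; E, (TangentSpace I : M → Type _)⟯

/-- Smooth endomorphism fields of the tangent bundle. -/
abbrev SmoothEndField : Type _ :=
  Cₛ^∞⟮I; E →L[ℝ] E, fun x : M => TangentSpace I x →L[ℝ] TangentSpace I x⟯

/-- Smooth fields of bilinear forms on the tangent spaces. -/
abbrev SmoothBilinField : Type _ :=
  Cₛ^∞⟮I; E →L[ℝ] E →L[ℝ] ℝ, fun x : M => TangentSpace I x →L[ℝ] TangentSpace I x →L[ℝ] ℝ⟯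

/-- Affine connections, `∇ Y x u = (∇_u Y)(x)`. -/
abbrev AffineConn : Type _ :=
  CovariantDerivative I E (TangentSpace I : M → Type _)

variable {I M}

/-- Vanishing of the curvature `∇_X ∇_Y Z - ∇_Y ∇_X Z - ∇_{[X, Y]} Z`. -/
def AffineConn.IsFlat (nabla : AffineConn I M) : Prop :=
  ∀ (X Y Z : SmoothVectorField I M) (x : M),
    nabla (fun y => nabla Z y (Y y)) x (X x) - nabla (fun y => nabla Z y (X y)) x (Y x)
      - nabla Z x (VectorField.mlieBracket I X Y x) = 0

/-- `∇ b = 0` for a field of bilinear forms `b`. -/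
def AffineConn.IsParallelBilin (nabla : AffineConn I M)
    (b : (x : M) → TangentSpace I x → TangentSpace I x → ℝ) : Prop :=
  ∀ (X Y Z : SmoothVectorField I M) (x : M),
    mvfderiv I (fun y => b y (Y y) (Z y)) x (X x)
      = b x (nabla Y x (X x)) (Z x) + b x (Y x) (nabla Z x (X x))

/-- `∇ J = 0` for an endomorphism field `J`. -/
def AffineConn.IsParallelEnd (nabla : AffineConn I M) (J : SmoothEndField I M) : Prop :=
  ∀ (X Y : SmoothVectorField I M) (x : M),
    nabla (fun y => J y (Y y)) x (X x) = J x (nabla Y x (X x))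

/-- `D` is the Levi-Civita connection of `g`: smooth, torsion-free and metric. -/
structure IsLeviCivita (D : AffineConn I M) (g : SmoothBilinField I M) : Prop where
  smooth : CovariantDerivative.ContMDiffCovariantDerivative D ∞
  torsionFree : D.torsion = 0
  metric : AffineConn.IsParallelBilin D (fun x u v => g x u v)

/-- `(M, J, g)` is pseudo-Kähler: `g` is a pseudo-Riemannian metric of arbitrary signature, `J` is
an orthogonal almost complex structure, and `J` is parallel for the Levi-Civita connection of `g`
(equivalently, `J` is integrable and `ω = g(·, J ·)` is closed). -/
structure IsPseudoKahler (J : SmoothEndField I M) (g : SmoothBilinField I M) : Prop where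
  J_sq : ∀ (x : M) (u : TangentSpace I x), J x (J x u) = -u
  g_symm : ∀ (x : M) (u v : TangentSpace I x), g x u v = g x v u
  g_nondeg : ∀ (x : M) (u : TangentSpace I x), (∀ v : TangentSpace I x, g x u v = 0) → u = 0
  g_J : ∀ (x : M) (u v : TangentSpace I x), g x (J x u) (J x v) = g x u v
  parallel_J : ∃ D : AffineConn I M, IsLeviCivita D g ∧ AffineConn.IsParallelEnd D J

variable (I M)

/-- An affine special Kähler structure `(J, g, ∇)` on the real smooth manifold `M`. -/
structure AffineSpecialKahler where
  /-- the complex structure -/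
  J : SmoothEndField I M
  /-- the pseudo-Kähler metric -/
  g : SmoothBilinField I M
  /-- the special connection -/
  nabla : AffineConn I M
  pseudoKahler : IsPseudoKahler J g
  nabla_smooth : CovariantDerivative.ContMDiffCovariantDerivative nabla ∞
  nabla_flat : AffineConn.IsFlat nabla
  nabla_torsionFree : nabla.torsion = 0
  /-- `∇ ω = 0` for `ω = g(·, J ·)` -/
  nabla_omega : AffineConn.IsParallelBilin nabla (fun x u v => g x u (J x v))
  /-- `d^∇ J = 0` -/
  d_nabla_J : ∀ (X Y : SmoothVectorField I M) (x : M),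
    nabla (fun y => J y (Y y)) x (X x) - nabla (fun y => J y (X y)) x (Y x)
      - J x (VectorField.mlieBracket I X Y x) = 0

/-- A conical affine special Kähler structure `(J, g, ∇, ξ)` on `M`. -/
structure ConicalAffineSpecialKahler extends AffineSpecialKahler I M where
  /-- the vector field `ξ` -/
  xi : SmoothVectorField I M
  g_xi : ∀ x : M, g x (xi x) (xi x) ≠ 0
  nabla_xi : ∀ (x : M) (u : TangentSpace I x), nabla xi x u = u
  leviCivita_xi : ∃ D : AffineConn I M, IsLeviCivita D g ∧
    ∀ (x : M) (u : TangentSpace I x), D xi x u = u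

variable {I M}

/-- Two conical affine special Kähler structures coincide: the same `J`, `g`, `ξ`, and the same
covariant derivatives of smooth vector fields. (The value of a `CovariantDerivative` on a
non-differentiable field carries no information.) -/
structure ConicalAffineSpecialKahler.Same (S T : ConicalAffineSpecialKahler I M) : Prop where
  J : ∀ (x : M) (u : TangentSpace I x), S.J x u = T.J x u
  g : ∀ (x : M) (u v : TangentSpace I x), S.g x u v = T.g x u v
  xi : ∀ x : M, S.xi x = T.xi x
  nabla : ∀ (Y : SmoothVectorField I M) (x : M) (u : TangentSpace I x),
    S.nabla Y x u = T.nabla Y x u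

/-! ## Kählerian Lagrangian immersions -/

/-- `φ^* γ` is non-degenerate. -/
def IsKahlerianMap {m : ℕ} (I : ModelWithCorners ℝ E H) (φ : M → CSymp m) : Prop :=
  ∀ (x : M) (u : TangentSpace I x),
    (∀ v : TangentSpace I x, hermForm (mvfderiv I φ x u) (mvfderiv I φ x v) = 0) → u = 0

/-- `φ : M → ℂ^{2m}` is a Kählerian Lagrangian immersion of the complex manifold `(M, J)`,
where `dim_ℝ M = 2m`. -/
structure IsKahlerianLagrangianImmersion {m : ℕ} (J : SmoothEndField I M) (φ : M → CSymp m) :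
    Prop where
  dim : Module.finrank ℝ E = 2 * m
  smooth : ContMDiff I 𝓘(ℝ, CSymp m) ∞ φ
  holomorphic : ∀ (x : M) (u : TangentSpace I x),
    mvfderiv I φ x (J x u) = Complex.I • mvfderiv I φ x u
  immersion : ∀ x : M, Function.Injective (mvfderiv I φ x)
  lagrangian : ∀ (x : M) (u v : TangentSpace I x),
    sympForm (mvfderiv I φ x u) (mvfderiv I φ x v) = 0
  kahlerian : IsKahlerianMap I φ

/-- The Kählerian Lagrangian immersion `φ` induces the affine special Kähler structure
`S = (J, g, ∇)`: `φ` is holomorphic for `J`, `g = Re φ^* γ`, and `∇` is the connection for which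
the real parts of the components of `φ` are affine functions, i.e.
`(∇_u Y) (Re φ_j) = u (Y (Re φ_j))`. -/
structure InducesASK {m : ℕ} (φ : M → CSymp m) (S : AffineSpecialKahler I M) : Prop where
  immersion : IsKahlerianLagrangianImmersion S.J φ
  metric : ∀ (x : M) (u v : TangentSpace I x),
    S.g x u v = (hermForm (mvfderiv I φ x u) (mvfderiv I φ x v)).re
  connection : ∀ (Y : SmoothVectorField I M) (x : M) (u : TangentSpace I x)
      (j : Fin m ⊕ Fin m),
    mvfderiv I (fun y => (φ y j).re) x (S.nabla Y x u)
      = mvfderiv I (fun y => mvfderiv I (fun y' => (φ y' j).re) y (Y y)) x u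

/-- `(φ, F)` is a special Kähler pair of `(M, S)`: `φ` is a Kählerian Lagrangian immersion inducing
`S`, and `F` is a prepotential of `φ`, i.e. `dF = φ^* (∑ w_i dz^i)`. -/
structure IsSpecialKahlerPair {n : ℕ} (S : AffineSpecialKahler I M) (p : ImmersionPair M n) :
    Prop where
  induces : InducesASK p.φ S
  smooth : ContMDiff I 𝓘(ℝ, ℂ) ∞ p.F
  prepotential : ∀ (x : M) (u : TangentSpace I x),
    mvfderiv I p.F x u = ∑ i : Fin n, p.φ x (Sum.inr i) * mvfderiv I p.φ x u (Sum.inl i)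

/-! ## Conification -/

/-- The conification `Φ : ℂ^* × M → ℂ^{2n+2}`, `Φ(z⁰, p) = z⁰ (1, (2F - zᵗ w)(p), φ(p))`. The
coordinates of `ℂ^{2n+2}` are `(z^0, …, z^n, w_0, …, w_n)`, the entries `1` and `2F - zᵗ w` being
those of `z^0` and `w_0`. -/
def ImmersionPair.con {M : Type*} {n : ℕ} (p : ImmersionPair M n) (q : ℂˣ × M) :
    CSymp (n + 1) :=
  (q.1 : ℂ) • Sum.elim
    (Fin.cons 1 (fun i => p.φ q.2 (Sum.inl i)))
    (Fin.cons (2 * p.F q.2 - pairingZW (p.φ q.2)) (fun i => p.φ q.2 (Sum.inr i)))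

/-- A pair `(φ, F)` is non-degenerate: its conification `Φ` is Kählerian and `γ(Φ, Φ)` has no
zeros. -/
structure ImmersionPair.IsNondegenerate {n : ℕ} (I : ModelWithCorners ℝ E H)
    (p : ImmersionPair M n) : Prop where
  kahlerian : IsKahlerianMap (𝓘(ℝ, ℂ).prod I) p.con
  hermForm_ne : ∀ q : ℂˣ × M, hermForm (p.con q) (p.con q) ≠ 0

/-- The conical affine special Kähler structure `T = (J, g, ∇, ξ)` on `ℂ^* × M` is the one induced
by the conification of `(φ, F)`: `(J, g, ∇)` is induced by `Φ`, `J` is the product complex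
structure of `ℂ^* × M` (both projections are holomorphic), and `ξ = z⁰ ∂/∂z⁰ + conj.` is the vector
field generating the action `e^t · (z⁰, p) = (e^t z⁰, p)` of `ℝ^{>0} ⊂ ℂ^*`. -/
structure ConInduces {n : ℕ} (S : AffineSpecialKahler I M) (p : ImmersionPair M n)
    (T : ConicalAffineSpecialKahler (𝓘(ℝ, ℂ).prod I) (ℂˣ × M)) : Prop where
  induces : InducesASK p.con T.toAffineSpecialKahler
  J_fst : ∀ (q : ℂˣ × M) (u : TangentSpace (𝓘(ℝ, ℂ).prod I) q),
    mvfderiv (𝓘(ℝ, ℂ).prod I) (fun q' : ℂˣ × M => (q'.1 : ℂ)) q (T.J q u)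
      = Complex.I * mvfderiv (𝓘(ℝ, ℂ).prod I) (fun q' : ℂˣ × M => (q'.1 : ℂ)) q u
  J_snd : ∀ (q : ℂˣ × M) (u : TangentSpace (𝓘(ℝ, ℂ).prod I) q),
    mfderiv (𝓘(ℝ, ℂ).prod I) I (Prod.snd : ℂˣ × M → M) q (T.J q u)
      = S.J q.2 (mfderiv (𝓘(ℝ, ℂ).prod I) I (Prod.snd : ℂˣ × M → M) q u)
  xi_fst : ∀ q : ℂˣ × M,
    mvfderiv (𝓘(ℝ, ℂ).prod I) (fun q' : ℂˣ × M => (q'.1 : ℂ)) q (T.xi q) = (q.1 : ℂ)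
  xi_snd : ∀ q : ℂˣ × M,
    mfderiv (𝓘(ℝ, ℂ).prod I) I (Prod.snd : ℂˣ × M → M) q (T.xi q) = 0

end Geometry

end

noncomputable section

open scoped Topology

section Calculus

variable {E : Type*} [NormedAddCommGroup E] [NormedSpace ℝ E]
  {H : Type*} [TopologicalSpace H] {I : ModelWithCorners ℝ E H}
  {M : Type*} [TopologicalSpace M] [ChartedSpace H M] [IsManifold I ∞ M]
  {W : Type*} [NormedAddCommGroup W] [NormedSpace ℝ W]

/-- The differential of a smooth function is smooth in a tangent trivialization. -/
theorem contMDiffAt_mvfderiv_comp_symmL {f : M → W} (hf : ContMDiff I 𝓘(ℝ, W) ∞ f) (x₀ : M) :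
    ContMDiffAt I 𝓘(ℝ, E →L[ℝ] W) ∞
      (fun x => mvfderiv I f x ∘L (trivializationAt E (TangentSpace I) x₀).symmL ℝ x) x₀ := by
  have h := (hf x₀).mfderiv_const (m := ∞) (by simp)
  refine h.congr_of_eventuallyEq ?_
  filter_upwards with x
  ext v
  simp [inTangentCoordinates, ContinuousLinearMap.inCoordinates, mvfderiv]
  rfl

theorem eventually_symmL_apply_continuousLinearMapAt (x₀ : M) :
    ∀ᶠ x in 𝓝 x₀, ∀ u : TangentSpace I x,
      (trivializationAt E (TangentSpace I) x₀).symmL ℝ x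
        ((trivializationAt E (TangentSpace I) x₀).continuousLinearMapAt ℝ x u) = u := by
  filter_upwards [(trivializationAt E (TangentSpace I) x₀).open_baseSet.mem_nhds
    (FiberBundle.mem_baseSet_trivializationAt' x₀)] with x hx u
  exact Bundle.Trivialization.symmL_continuousLinearMapAt _ hx u

theorem contMDiffAt_tangent_section {Y : (x : M) → TangentSpace I x} {x₀ : M} {n : WithTop ℕ∞} :
    ContMDiffAt I (I.prod 𝓘(ℝ, E)) n (fun x => (⟨x, Y x⟩ : Bundle.TotalSpace E (TangentSpace I))) x₀ ↔
    ContMDiffAt I 𝓘(ℝ, E) n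
      (fun x => (trivializationAt E (TangentSpace I) x₀).continuousLinearMapAt ℝ x (Y x)) x₀ := by
  rw [Bundle.contMDiffAt_section]
  refine Filter.EventuallyEq.contMDiffAt_iff ?_
  filter_upwards [(trivializationAt E (TangentSpace I) x₀).open_baseSet.mem_nhds
    (FiberBundle.mem_baseSet_trivializationAt' x₀)] with x hx
  rw [Bundle.Trivialization.continuousLinearMapAt_apply, Bundle.Trivialization.linearMapAt_apply,
    if_pos hx]

theorem mdifferentiableAt_tangent_section {Y : (x : M) → TangentSpace I x} {x₀ : M} :
    MDifferentiableAt I (I.prod 𝓘(ℝ, E))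
      (fun x => (⟨x, Y x⟩ : Bundle.TotalSpace E (TangentSpace I))) x₀ ↔
    MDifferentiableAt I 𝓘(ℝ, E)
      (fun x => (trivializationAt E (TangentSpace I) x₀).continuousLinearMapAt ℝ x (Y x)) x₀ := by
  rw [mdifferentiableAt_section]
  refine Filter.EventuallyEq.mdifferentiableAt_iff ?_
  filter_upwards [(trivializationAt E (TangentSpace I) x₀).open_baseSet.mem_nhds
    (FiberBundle.mem_baseSet_trivializationAt' x₀)] with x hx
  rw [Bundle.Trivialization.continuousLinearMapAt_apply, Bundle.Trivialization.linearMapAt_apply,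
    if_pos hx]

theorem contMDiffAt_mvfderiv_apply {f : M → W} (hf : ContMDiff I 𝓘(ℝ, W) ∞ f)
    {Y : (x : M) → TangentSpace I x} {x₀ : M}
    (hY : ContMDiffAt I (I.prod 𝓘(ℝ, E)) ∞
      (fun x => (⟨x, Y x⟩ : Bundle.TotalSpace E (TangentSpace I))) x₀) :
    ContMDiffAt I 𝓘(ℝ, W) ∞ (fun x => mvfderiv I f x (Y x)) x₀ := by
  refine ((contMDiffAt_mvfderiv_comp_symmL hf x₀).clm_apply
    (contMDiffAt_tangent_section.1 hY)).congr_of_eventuallyEq ?_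
  filter_upwards [eventually_symmL_apply_continuousLinearMapAt (I := I) x₀] with x hx
  rw [ContinuousLinearMap.comp_apply, hx]

theorem mdifferentiableAt_mvfderiv_apply {f : M → W} (hf : ContMDiff I 𝓘(ℝ, W) ∞ f)
    {Y : (x : M) → TangentSpace I x} {x₀ : M}
    (hY : MDifferentiableAt I (I.prod 𝓘(ℝ, E))
      (fun x => (⟨x, Y x⟩ : Bundle.TotalSpace E (TangentSpace I))) x₀) :
    MDifferentiableAt I 𝓘(ℝ, W) (fun x => mvfderiv I f x (Y x)) x₀ := by
  refine (((contMDiffAt_mvfderiv_comp_symmL hf x₀).mdifferentiableAt (by simp)).clm_apply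
    (mdifferentiableAt_tangent_section.1 hY)).congr_of_eventuallyEq ?_
  filter_upwards [eventually_symmL_apply_continuousLinearMapAt (I := I) x₀] with x hx
  rw [ContinuousLinearMap.comp_apply, hx]

theorem contMDiffAt_end_section {s : (x : M) → TangentSpace I x →L[ℝ] TangentSpace I x} {x₀ : M} :
    ContMDiffAt I (I.prod 𝓘(ℝ, E →L[ℝ] E)) ∞
      (fun x => (⟨x, s x⟩ : Bundle.TotalSpace (E →L[ℝ] E)
        fun x : M => TangentSpace I x →L[ℝ] TangentSpace I x)) x₀ ↔
    ContMDiffAt I 𝓘(ℝ, E →L[ℝ] E) ∞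
      (fun x => (trivializationAt E (TangentSpace I) x₀).continuousLinearMapAt ℝ x ∘L s x ∘L
        (trivializationAt E (TangentSpace I) x₀).symmL ℝ x) x₀ := by
  rw [contMDiffAt_hom_bundle]
  exact and_iff_right contMDiffAt_id

/-- The pullback of a bilinear form `β` on `W` by a linear map into `W`. -/
def pullbackBilin {T : Type*} [AddCommGroup T] [Module ℝ T] [TopologicalSpace T]
    [IsTopologicalAddGroup T] [ContinuousSMul ℝ T] (β : W →L[ℝ] W →L[ℝ] ℝ) (P : T →L[ℝ] W) :
    T →L[ℝ] T →L[ℝ] ℝ :=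
  ContinuousLinearMap.precomp ℝ P ∘L β ∘L P

theorem pullbackBilin_apply {T : Type*} [AddCommGroup T] [Module ℝ T] [TopologicalSpace T]
    [IsTopologicalAddGroup T] [ContinuousSMul ℝ T] (β : W →L[ℝ] W →L[ℝ] ℝ) (P : T →L[ℝ] W)
    (u v : T) : pullbackBilin β P u v = β (P u) (P v) := rfl

theorem contMDiffAt_pullbackBilin {N : Type*} [TopologicalSpace N] [ChartedSpace H N]
    (β : W →L[ℝ] W →L[ℝ] ℝ) {P : N → E →L[ℝ] W} {x₀ : N}
    (hP : ContMDiffAt I 𝓘(ℝ, E →L[ℝ] W) ∞ P x₀) :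
    ContMDiffAt I 𝓘(ℝ, E →L[ℝ] E →L[ℝ] ℝ) ∞ (fun x => pullbackBilin β (P x)) x₀ := by
  have h1 : ContMDiffAt I 𝓘(ℝ, (W →L[ℝ] ℝ) →L[ℝ] (E →L[ℝ] ℝ)) ∞
      (fun x => (ContinuousLinearMap.compL ℝ E W ℝ).flip (P x)) x₀ :=
    (ContinuousLinearMap.contMDiff _).contMDiffAt.comp x₀ hP
  exact h1.clm_comp (contMDiffAt_const.clm_comp hP)

theorem contMDiff_pullbackBilin_section (β : W →L[ℝ] W →L[ℝ] ℝ) {f : M → W}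
    (hf : ContMDiff I 𝓘(ℝ, W) ∞ f) :
    ContMDiff I (I.prod 𝓘(ℝ, E →L[ℝ] E →L[ℝ] ℝ)) ∞
      (fun x => (⟨x, pullbackBilin β (mvfderiv I f x)⟩ : Bundle.TotalSpace (E →L[ℝ] E →L[ℝ] ℝ)
        fun x : M => TangentSpace I x →L[ℝ] TangentSpace I x →L[ℝ] ℝ)) := by
  intro x₀
  refine (contMDiffAt_hom_bundle _).2 ⟨contMDiffAt_id, ?_⟩
  refine (contMDiffAt_pullbackBilin β
    (contMDiffAt_mvfderiv_comp_symmL hf x₀)).congr_of_eventuallyEq ?_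
  filter_upwards [(trivializationAt E (TangentSpace I) x₀).open_baseSet.mem_nhds
    (FiberBundle.mem_baseSet_trivializationAt' x₀)] with x hx
  ext u v
  have hx' : x ∈ (trivializationAt (E →L[ℝ] ℝ)
      (fun x : M => TangentSpace I x →L[ℝ] ℝ) x₀).baseSet := by
    simpa [hom_trivializationAt_baseSet] using hx
  simp only [ContinuousLinearMap.inCoordinates, ContinuousLinearMap.comp_apply,
    Bundle.Trivialization.continuousLinearMapAt_apply, Bundle.Trivialization.linearMapAt_apply,
    if_pos hx', hom_trivializationAt_apply, pullbackBilin_apply]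
  exact if_pos (Set.mem_univ x)

theorem isInvertible_symmL {x₀ x : M}
    (hx : x ∈ (trivializationAt E (TangentSpace I : M → Type _) x₀).baseSet) :
    ((trivializationAt E (TangentSpace I) x₀).symmL ℝ x).IsInvertible :=
  ContinuousLinearMap.IsInvertible.of_inverse
    (g := (trivializationAt E (TangentSpace I) x₀).continuousLinearMapAt ℝ x)
    (by ext u; exact Bundle.Trivialization.symmL_continuousLinearMapAt _ hx u)
    (by ext u; exact Bundle.Trivialization.continuousLinearMapAt_symmL _ hx u)

theorem contMDiffAt_inverse_mvfderiv_comp_symmL [CompleteSpace E] {f : M → W}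
    (hf : ContMDiff I 𝓘(ℝ, W) ∞ f) (hinv : ∀ x, (mvfderiv I f x).IsInvertible) (x₀ : M) :
    ContMDiffAt I 𝓘(ℝ, W →L[ℝ] E) ∞ (fun x =>
      (mvfderiv I f x ∘L (trivializationAt E (TangentSpace I) x₀).symmL ℝ x).inverse) x₀ := by
  have h : ((mvfderiv I f x₀) ∘L
      (trivializationAt E (TangentSpace I) x₀).symmL ℝ x₀).IsInvertible :=
    (hinv x₀).comp (isInvertible_symmL (FiberBundle.mem_baseSet_trivializationAt' x₀))
  exact (h.contDiffAt_map_inverse.contMDiffAt).comp x₀ (contMDiffAt_mvfderiv_comp_symmL hf x₀)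

theorem eventually_inverse_mvfderiv_comp_symmL_apply {f : M → W}
    (hinv : ∀ x, (mvfderiv I f x).IsInvertible) (x₀ : M) :
    ∀ᶠ x in 𝓝 x₀, ∀ u : TangentSpace I x,
      (mvfderiv I f x ∘L (trivializationAt E (TangentSpace I) x₀).symmL ℝ x).inverse
        (mvfderiv I f x u) =
      (trivializationAt E (TangentSpace I) x₀).continuousLinearMapAt ℝ x u := by
  filter_upwards [(trivializationAt E (TangentSpace I) x₀).open_baseSet.mem_nhds
    (FiberBundle.mem_baseSet_trivializationAt' x₀)] with x hx u
  rw [ContinuousLinearMap.IsInvertible.inverse_apply_eq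
    ((hinv x).comp (isInvertible_symmL hx)), ContinuousLinearMap.comp_apply,
    Bundle.Trivialization.symmL_continuousLinearMapAt _ hx u]

/-- A vector field is smooth if its image under a pointwise invertible differential is. -/
theorem contMDiff_section_of_mvfderiv_apply [CompleteSpace E] {f : M → W}
    (hf : ContMDiff I 𝓘(ℝ, W) ∞ f) (hinv : ∀ x, (mvfderiv I f x).IsInvertible) {Y : (x : M) → TangentSpace I x}
    (hY : ContMDiff I 𝓘(ℝ, W) ∞ (fun x => mvfderiv I f x (Y x))) :
    ContMDiff I (I.prod 𝓘(ℝ, E)) ∞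
      (fun x => (⟨x, Y x⟩ : Bundle.TotalSpace E (TangentSpace I))) := by
  intro x₀
  refine contMDiffAt_tangent_section.2 (((contMDiffAt_inverse_mvfderiv_comp_symmL hf hinv
    x₀).clm_apply (hY x₀)).congr_of_eventuallyEq ?_)
  filter_upwards [eventually_inverse_mvfderiv_comp_symmL_apply hinv x₀] with x hx
  rw [hx]

/-- An endomorphism field is smooth if its composition with a pointwise invertible differential
is, in tangent trivializations. -/
theorem contMDiffAt_end_section_of_mvfderiv_comp [CompleteSpace E] {f : M → W}
    (hf : ContMDiff I 𝓘(ℝ, W) ∞ f) (hinv : ∀ x, (mvfderiv I f x).IsInvertible)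
    {s : (x : M) → TangentSpace I x →L[ℝ] TangentSpace I x} {x₀ : M}
    (hs : ContMDiffAt I 𝓘(ℝ, E →L[ℝ] W) ∞ (fun x =>
      mvfderiv I f x ∘L s x ∘L (trivializationAt E (TangentSpace I) x₀).symmL ℝ x) x₀) :
    ContMDiffAt I (I.prod 𝓘(ℝ, E →L[ℝ] E)) ∞
      (fun x => (⟨x, s x⟩ : Bundle.TotalSpace (E →L[ℝ] E)
        fun x : M => TangentSpace I x →L[ℝ] TangentSpace I x)) x₀ := by
  refine contMDiffAt_end_section.2 (((contMDiffAt_inverse_mvfderiv_comp_symmL hf hinv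
    x₀).clm_comp hs).congr_of_eventuallyEq ?_)
  filter_upwards [eventually_inverse_mvfderiv_comp_symmL_apply hinv x₀] with x hx
  ext u
  simp only [ContinuousLinearMap.comp_apply, hx]

end Calculus

section Bracket

variable {E : Type*} [NormedAddCommGroup E] [NormedSpace ℝ E]
  {H : Type*} [TopologicalSpace H] {I : ModelWithCorners ℝ E H}
  {M : Type*} [TopologicalSpace M] [ChartedSpace H M]
  {W : Type*} [NormedAddCommGroup W] [NormedSpace ℝ W]

theorem mvfderiv_eq_fderiv_comp_extChartAt_symm [I.Boundaryless] {h : M → W} {x : M}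
    (hh : MDifferentiableAt I 𝓘(ℝ, W) h x) :
    (mvfderiv I h x : E →L[ℝ] W) = fderiv ℝ (h ∘ (extChartAt I x).symm) (extChartAt I x x) := by
  rw [hh.mvfderiv, I.range_eq_univ, fderivWithin_univ]
  rfl

/-- A vector field read in the chart at `x`. -/
def fieldInChart (I : ModelWithCorners ℝ E H) (X : (y : M) → TangentSpace I y) (x : M) : E → E :=
  VectorField.mpullbackWithin 𝓘(ℝ, E) I (extChartAt I x).symm X (Set.range I)

theorem fieldInChart_self [IsManifold I ∞ M] (X : (y : M) → TangentSpace I y) (x : M) :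
    fieldInChart I X x (extChartAt I x x) = X x := by
  have h : (X ((extChartAt I x).symm (extChartAt I x x)) : E) = X x :=
    congrArg (fun y => (X y : E)) (extChartAt_to_inv x)
  refine Eq.trans ?_ (mfderivWithin_extChartAt_symm_inverse_apply (X x))
  exact congrArg _ h

theorem eventually_fderiv_fieldInChart [I.Boundaryless] [IsManifold I ∞ M]
    {f : M → W} (hf : ContMDiff I 𝓘(ℝ, W) ∞ f)
    (X : (y : M) → TangentSpace I y) (x : M) :
    (fun y => mvfderiv I f y (X y)) ∘ (extChartAt I x).symm =ᶠ[𝓝 (extChartAt I x x)]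
      fun e => fderiv ℝ (f ∘ (extChartAt I x).symm) e (fieldInChart I X x e) := by
  filter_upwards [extChartAt_target_mem_nhds (I := I) x] with e he
  have h1 : MDifferentiableAt 𝓘(ℝ, E) I (extChartAt I x).symm e := by
    have := mdifferentiableWithinAt_extChartAt_symm (I := I) he
    rwa [I.range_eq_univ, mdifferentiableWithinAt_univ] at this
  have h2 := mfderiv_comp e ((hf _).mdifferentiableAt (by simp)) h1
  have h3 := isInvertible_mfderivWithin_extChartAt_symm (I := I) he
  have h4 := h3.self_apply_inverse (X ((extChartAt I x).symm e))
  rw [mfderiv_eq_fderiv] at h2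
  rw [h2]
  simp only [fieldInChart, VectorField.mpullbackWithin_apply, I.range_eq_univ,
    mfderivWithin_univ] at h4 ⊢
  exact congrArg (mfderiv I 𝓘(ℝ, W) f ((extChartAt I x).symm e)) h4.symm

theorem contDiffAt_comp_extChartAt_symm [I.Boundaryless] {f : M → W} (hf : ContMDiff I 𝓘(ℝ, W) ∞ f) (x : M) :
    ContDiffAt ℝ ∞ (f ∘ (extChartAt I x).symm) (extChartAt I x x) := by
  have := (contMDiffAt_iff.1 (hf x)).2
  rw [I.range_eq_univ, contDiffWithinAt_univ] at this
  exact this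

theorem differentiableAt_fieldInChart [I.Boundaryless] [IsManifold I ∞ M]
    [CompleteSpace E] {X : (y : M) → TangentSpace I y} {x : M}
    (hX : MDifferentiableAt I (I.prod 𝓘(ℝ, E))
      (fun y => (⟨y, X y⟩ : Bundle.TotalSpace E (TangentSpace I))) x) :
    DifferentiableAt ℝ (fieldInChart I X x) (extChartAt I x x) := by
  have : IsManifold I 2 M := IsManifold.of_le (n := ∞) (by norm_cast)
  have h : DifferentiableWithinAt ℝ (fieldInChart I X x)
      ((extChartAt I x).symm ⁻¹' Set.univ ∩ Set.range I) (extChartAt I x x) :=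
    MDifferentiableWithinAt.differentiableWithinAt_mpullbackWithin_vectorField
      (s := Set.univ) (mdifferentiableWithinAt_univ.2 hX)
  rwa [I.range_eq_univ, Set.preimage_univ, Set.inter_univ, differentiableWithinAt_univ] at h

theorem mlieBracket_eq_lieBracketWithin [IsManifold I ∞ M] (X Y : (y : M) → TangentSpace I y) (x : M) :
    (VectorField.mlieBracket I X Y x : E) =
      VectorField.lieBracketWithin ℝ (fieldInChart I X x) (fieldInChart I Y x)
        ((extChartAt I x).symm ⁻¹' Set.univ ∩ Set.range I) (extChartAt I x x) := by
  rw [← VectorField.mlieBracketWithin_univ, VectorField.mlieBracketWithin_apply,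
    mfderiv_extChartAt_self]
  erw [ContinuousLinearMap.inverse_id]
  rfl

theorem mlieBracket_eq_fieldInChart [I.Boundaryless] [IsManifold I ∞ M]
    (X Y : (y : M) → TangentSpace I y) (x : M) :
    (VectorField.mlieBracket I X Y x : E) =
      fderiv ℝ (fieldInChart I Y x) (extChartAt I x x) (X x)
        - fderiv ℝ (fieldInChart I X x) (extChartAt I x x) (Y x) := by
  rw [mlieBracket_eq_lieBracketWithin, I.range_eq_univ, Set.preimage_univ, Set.inter_univ,
    VectorField.lieBracketWithin_univ, VectorField.lieBracket, fieldInChart_self, fieldInChart_self]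

/-- `df [X, Y] = X (df Y) - Y (df X)`. -/
theorem mvfderiv_mlieBracket [I.Boundaryless] [IsManifold I ∞ M]
    [CompleteSpace E] {f : M → W} (hf : ContMDiff I 𝓘(ℝ, W) ∞ f)
    {X Y : (y : M) → TangentSpace I y} {x : M}
    (hX : MDifferentiableAt I (I.prod 𝓘(ℝ, E))
      (fun y => (⟨y, X y⟩ : Bundle.TotalSpace E (TangentSpace I))) x)
    (hY : MDifferentiableAt I (I.prod 𝓘(ℝ, E))
      (fun y => (⟨y, Y y⟩ : Bundle.TotalSpace E (TangentSpace I))) x) :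
    mvfderiv I f x (VectorField.mlieBracket I X Y x) =
      mvfderiv I (fun y => mvfderiv I f y (Y y)) x (X x)
        - mvfderiv I (fun y => mvfderiv I f y (X y)) x (Y x) := by
  have hd := contDiffAt_comp_extChartAt_symm hf x
  have hd' : DifferentiableAt ℝ (fderiv ℝ (f ∘ (extChartAt I x).symm)) (extChartAt I x x) :=
    (hd.fderiv_right (m := 1) (by norm_cast)).differentiableAt (by simp)
  have key : ∀ {X Y : (y : M) → TangentSpace I y}, MDifferentiableAt I (I.prod 𝓘(ℝ, E))
      (fun y => (⟨y, Y y⟩ : Bundle.TotalSpace E (TangentSpace I))) x →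
      mvfderiv I (fun y => mvfderiv I f y (Y y)) x (X x) =
      fderiv ℝ (fderiv ℝ (f ∘ (extChartAt I x).symm)) (extChartAt I x x) (X x) (Y x) +
      fderiv ℝ (f ∘ (extChartAt I x).symm) (extChartAt I x x)
        (fderiv ℝ (fieldInChart I Y x) (extChartAt I x x) (X x)) := by
    intro X Y hY
    have h1 := mvfderiv_eq_fderiv_comp_extChartAt_symm (mdifferentiableAt_mvfderiv_apply hf hY)
    rw [(eventually_fderiv_fieldInChart hf Y x).fderiv_eq,
      (hd'.hasFDerivAt.clm_apply (differentiableAt_fieldInChart hY).hasFDerivAt).fderiv] at h1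
    refine (DFunLike.congr_fun h1 (X x)).trans ?_
    have h2 : ∀ (A : E →L[ℝ] E →L[ℝ] W) (L : E →L[ℝ] W) (D : E →L[ℝ] E) (a b : E),
        (L ∘L D + A.flip b) a = A a b + L (D a) := by
      intro A L D a b
      simp [add_comm]
    refine (h2 _ _ _ _ _).trans ?_
    rw [fieldInChart_self]
  have hs := (hd.isSymmSndFDerivAt (by simp; norm_cast)) (X x) (Y x)
  have h2 := DFunLike.congr_fun
    (mvfderiv_eq_fderiv_comp_extChartAt_symm ((hf x).mdifferentiableAt (by simp)))
    (VectorField.mlieBracket I X Y x)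
  rw [key hY, key hX, hs]
  refine h2.trans ?_
  rw [mlieBracket_eq_fieldInChart]
  have h3 : ∀ (L : E →L[ℝ] W) (a b : E) (c : W), L (a - b) = c + L a - (c + L b) := by
    intro L a b c
    rw [map_sub]
    abel
  exact h3 _ _ _ _

end Bracket

section FrameConnection

variable {E : Type*} [NormedAddCommGroup E] [NormedSpace ℝ E] [FiniteDimensional ℝ E]
  {H : Type*} [TopologicalSpace H] {I : ModelWithCorners ℝ E H}
  {M : Type*} [TopologicalSpace M] [ChartedSpace H M] [IsManifold I ∞ M]
  {W : Type*} [NormedAddCommGroup W] [NormedSpace ℝ W]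

theorem mvfderiv_comp_differentiableAt {W' : Type*} [NormedAddCommGroup W'] [NormedSpace ℝ W']
    {F : W → W'} {f : M → W} {x : M} (hF : DifferentiableAt ℝ F (f x))
    (hf : MDifferentiableAt I 𝓘(ℝ, W) f x) :
    mvfderiv I (fun y => F (f y)) x = fderiv ℝ F (f x) ∘L mvfderiv I f x := by
  have h := mfderiv_comp x hF.mdifferentiableAt hf
  rw [mfderiv_eq_fderiv] at h
  exact h

theorem mvfderiv_clm_comp {W' : Type*} [NormedAddCommGroup W'] [NormedSpace ℝ W']
    (L : W →L[ℝ] W') {f : M → W} {x : M} (hf : MDifferentiableAt I 𝓘(ℝ, W) f x) :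
    mvfderiv I (fun y => L (f y)) x = L ∘L mvfderiv I f x := by
  rw [mvfderiv_comp_differentiableAt L.differentiableAt hf, L.fderiv]

theorem mvfderiv_prodMk {W' : Type*} [NormedAddCommGroup W'] [NormedSpace ℝ W']
    {a : M → W} {b : M → W'} {x : M} (ha : MDifferentiableAt I 𝓘(ℝ, W) a x)
    (hb : MDifferentiableAt I 𝓘(ℝ, W') b x) :
    mvfderiv I (fun y => (a y, b y)) x = (mvfderiv I a x).prod (mvfderiv I b x) := by
  have h := ha.prodMk_space hb
  have h1 := mvfderiv_clm_comp (ContinuousLinearMap.fst ℝ W W') h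
  have h2 := mvfderiv_clm_comp (ContinuousLinearMap.snd ℝ W W') h
  ext1 u
  exact Prod.ext (DFunLike.congr_fun h1 u).symm (DFunLike.congr_fun h2 u).symm

/-- Product rule for a bilinear map with constant coefficients. -/
theorem mvfderiv_bilin {W' W'' : Type*} [NormedAddCommGroup W'] [NormedSpace ℝ W']
    [NormedAddCommGroup W''] [NormedSpace ℝ W''] (β : W →L[ℝ] W' →L[ℝ] W'') {a : M → W}
    {b : M → W'} {x : M} (ha : MDifferentiableAt I 𝓘(ℝ, W) a x)
    (hb : MDifferentiableAt I 𝓘(ℝ, W') b x) (u : TangentSpace I x) :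
    mvfderiv I (fun y => β (a y) (b y)) x u =
      β (mvfderiv I a x u) (b x) + β (a x) (mvfderiv I b x u) := by
  have h := mvfderiv_comp_differentiableAt (F := fun p : W × W' => β p.1 p.2)
    (f := fun y => (a y, b y))
    (β.isBoundedBilinearMap.differentiableAt (a x, b x)) (ha.prodMk_space hb)
  rw [h, ContinuousLinearMap.comp_apply, β.isBoundedBilinearMap.fderiv, mvfderiv_prodMk ha hb]
  exact add_comm _ _

theorem SmoothVectorField.mdifferentiableAt_mk (Y : SmoothVectorField I M) (x : M) :
    MDifferentiableAt I (I.prod 𝓘(ℝ, E))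
      (fun y => (⟨y, Y y⟩ : Bundle.TotalSpace E (TangentSpace I))) x :=
  Y.mdifferentiableAt

/-- The connection for which a local diffeomorphism `f` to a vector space is affine. -/
def frameConn (f : M → W) (hf : ContMDiff I 𝓘(ℝ, W) ∞ f)
    (hinv : ∀ x, (mvfderiv I f x).IsInvertible) : AffineConn I M where
  toFun σ x := (mvfderiv I f x).inverse ∘L mvfderiv I (fun y => mvfderiv I f y (σ y)) x
  isCovariantDerivativeOnUniv :=
    { add := by
        intro σ σ' x hσ hσ' _
        have h : (fun y => mvfderiv I f y ((σ + σ') y)) =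
            fun y => mvfderiv I f y (σ y) + mvfderiv I f y (σ' y) := by
          ext1 y
          exact map_add _ _ _
        rw [h, mvfderiv_fun_add (mdifferentiableAt_mvfderiv_apply hf hσ)
          (mdifferentiableAt_mvfderiv_apply hf hσ'), ContinuousLinearMap.comp_add]
      leibniz := by
        intro σ g x hσ hg _
        have h : (fun y => mvfderiv I f y ((g • σ) y)) =
            fun y => g y • mvfderiv I f y (σ y) := by
          ext1 y
          exact map_smul _ _ _
        rw [h, mvfderiv_fun_smul hg (mdifferentiableAt_mvfderiv_apply hf hσ)]
        ext u
        simp only [ContinuousLinearMap.comp_apply, add_apply, smul_apply,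
          ContinuousLinearMap.smulRight_apply, map_add, map_smul, (hinv x).inverse_apply_self] }

variable {f : M → W} (hf : ContMDiff I 𝓘(ℝ, W) ∞ f)
    (hinv : ∀ x, (mvfderiv I f x).IsInvertible)

theorem mvfderiv_frameConn (σ : (x : M) → TangentSpace I x) (x : M) (u : TangentSpace I x) :
    mvfderiv I f x (frameConn f hf hinv σ x u) = mvfderiv I (fun y => mvfderiv I f y (σ y)) x u :=
  (hinv x).self_apply_inverse _

theorem contMDiff_frameConn {σ : (x : M) → TangentSpace I x}
    (hσ : ContMDiff I (I.prod 𝓘(ℝ, E)) ∞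
      (fun y => (⟨y, σ y⟩ : Bundle.TotalSpace E (TangentSpace I)))) :
    ContMDiff I (I.prod 𝓘(ℝ, E →L[ℝ] E)) ∞
      (fun x => (⟨x, frameConn f hf hinv σ x⟩ : Bundle.TotalSpace (E →L[ℝ] E)
        fun x : M => TangentSpace I x →L[ℝ] TangentSpace I x)) := by
  intro x₀
  refine contMDiffAt_end_section_of_mvfderiv_comp hf hinv ?_
  refine (contMDiffAt_mvfderiv_comp_symmL
    (fun x => contMDiffAt_mvfderiv_apply hf (hσ x)) x₀).congr_of_eventuallyEq ?_
  filter_upwards with x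
  ext u
  exact mvfderiv_frameConn hf hinv σ x _

theorem frameConn_smooth :
    CovariantDerivative.ContMDiffCovariantDerivative (frameConn f hf hinv) ∞ where
  contMDiff :=
    { contMDiff := fun hσ => (contMDiff_frameConn hf hinv (contMDiffOn_univ.1 hσ)).contMDiffOn }

theorem frameConn_flat [I.Boundaryless] : AffineConn.IsFlat (frameConn f hf hinv) := by
  intro X Y Z x
  have hZ := fun x => contMDiffAt_mvfderiv_apply hf (Z.contMDiff x)
  apply (hinv x).injective
  rw [map_sub, map_sub, map_zero, mvfderiv_frameConn, mvfderiv_frameConn, mvfderiv_frameConn,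
    mvfderiv_mlieBracket hZ (X.mdifferentiableAt_mk x) (Y.mdifferentiableAt_mk x)]
  simp only [mvfderiv_frameConn, sub_self]

theorem frameConn_torsionFree [I.Boundaryless] : (frameConn f hf hinv).torsion = 0 := by
  refine (CovariantDerivative.torsion_eq_zero_iff _).2 ?_
  intro X Y x hX hY
  apply (hinv x).injective
  rw [map_sub, mvfderiv_frameConn, mvfderiv_frameConn, mvfderiv_mlieBracket hf hX hY]

theorem frameConn_parallelBilin (β : W →L[ℝ] W →L[ℝ] ℝ)
    {b : (x : M) → TangentSpace I x → TangentSpace I x → ℝ}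
    (hb : ∀ x u v, b x u v = β (mvfderiv I f x u) (mvfderiv I f x v)) :
    AffineConn.IsParallelBilin (frameConn f hf hinv) b := by
  intro X Y Z x
  simp only [hb, mvfderiv_frameConn]
  exact mvfderiv_bilin β (mdifferentiableAt_mvfderiv_apply hf (Y.mdifferentiableAt_mk x))
    (mdifferentiableAt_mvfderiv_apply hf (Z.mdifferentiableAt_mk x)) _

end FrameConnection

section HalfConnection

variable {E : Type*} [NormedAddCommGroup E] [NormedSpace ℝ E] [FiniteDimensional ℝ E]
  {H : Type*} [TopologicalSpace H] {I : ModelWithCorners ℝ E H}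
  {M : Type*} [TopologicalSpace M] [ChartedSpace H M] [IsManifold I ∞ M]

theorem contMDiff_end_comp {s t : (x : M) → TangentSpace I x →L[ℝ] TangentSpace I x}
    (hs : ContMDiff I (I.prod 𝓘(ℝ, E →L[ℝ] E)) ∞
      (fun x => (⟨x, s x⟩ : Bundle.TotalSpace (E →L[ℝ] E)
        fun x : M => TangentSpace I x →L[ℝ] TangentSpace I x)))
    (ht : ContMDiff I (I.prod 𝓘(ℝ, E →L[ℝ] E)) ∞
      (fun x => (⟨x, t x⟩ : Bundle.TotalSpace (E →L[ℝ] E)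
        fun x : M => TangentSpace I x →L[ℝ] TangentSpace I x))) :
    ContMDiff I (I.prod 𝓘(ℝ, E →L[ℝ] E)) ∞
      (fun x => (⟨x, s x ∘L t x⟩ : Bundle.TotalSpace (E →L[ℝ] E)
        fun x : M => TangentSpace I x →L[ℝ] TangentSpace I x)) := by
  intro x₀
  refine contMDiffAt_end_section.2 (((contMDiffAt_end_section.1 (hs x₀)).clm_comp
    (contMDiffAt_end_section.1 (ht x₀))).congr_of_eventuallyEq ?_)
  filter_upwards [eventually_symmL_apply_continuousLinearMapAt (I := I) x₀] with x hx
  ext u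
  simp only [ContinuousLinearMap.comp_apply, hx]

namespace SmoothEndField

variable (J : SmoothEndField I M)

/-- The vector field `J Y`. -/
def applyField (Y : SmoothVectorField I M) : SmoothVectorField I M :=
  ⟨fun x => J x (Y x), J.contMDiff.clm_bundle_apply Y.contMDiff⟩

theorem mdifferentiableAt_apply {σ : (x : M) → TangentSpace I x} {x : M}
    (hσ : MDifferentiableAt I (I.prod 𝓘(ℝ, E))
      (fun y => (⟨y, σ y⟩ : Bundle.TotalSpace E (TangentSpace I))) x) :
    MDifferentiableAt I (I.prod 𝓘(ℝ, E))
      (fun y => (⟨y, J y (σ y)⟩ : Bundle.TotalSpace E (TangentSpace I))) x :=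
  (J.mdifferentiableAt (x := x)).clm_bundle_apply hσ

end SmoothEndField

/-- The connection `½ (∇ - J ∇ J)`, for an almost complex structure `J`. -/
def AffineConn.complexPart (nabla : AffineConn I M) (J : SmoothEndField I M)
    (hJ : ∀ (x : M) (u : TangentSpace I x), J x (J x u) = -u) : AffineConn I M where
  toFun σ x := (1 / 2 : ℝ) • (nabla σ x - J x ∘L nabla (fun y => J y (σ y)) x)
  isCovariantDerivativeOnUniv :=
    { add := by
        intro σ σ' x hσ hσ' _
        have h : (fun y => J y ((σ + σ') y)) =
            (fun y => J y (σ y)) + fun y => J y (σ' y) := by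
          ext1 y
          exact map_add _ _ _
        rw [h, nabla.isCovariantDerivativeOnUniv.add hσ hσ',
          nabla.isCovariantDerivativeOnUniv.add (J.mdifferentiableAt_apply hσ)
            (J.mdifferentiableAt_apply hσ'), ContinuousLinearMap.comp_add]
        module
      leibniz := by
        intro σ g x hσ hg _
        have h : (fun y => J y ((g • σ) y)) = g • fun y => J y (σ y) := by
          ext1 y
          exact map_smul _ _ _
        rw [h, nabla.isCovariantDerivativeOnUniv.leibniz hσ hg,
          nabla.isCovariantDerivativeOnUniv.leibniz (J.mdifferentiableAt_apply hσ) hg]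
        ext u
        simp only [ContinuousLinearMap.comp_apply, add_apply, smul_apply, sub_apply,
          ContinuousLinearMap.smulRight_apply, map_add, map_smul, hJ]
        module }

section

variable {nabla : AffineConn I M} {J : SmoothEndField I M}
  {hJ : ∀ (x : M) (u : TangentSpace I x), J x (J x u) = -u}

theorem AffineConn.complexPart_apply (σ : (x : M) → TangentSpace I x) (x : M)
    (u : TangentSpace I x) : nabla.complexPart J hJ σ x u =
      (1 / 2 : ℝ) • (nabla σ x u - J x (nabla (fun y => J y (σ y)) x u)) := rfl

theorem AffineConn.complexPart_smooth
    (h : CovariantDerivative.ContMDiffCovariantDerivative nabla ∞) :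
    CovariantDerivative.ContMDiffCovariantDerivative (nabla.complexPart J hJ) ∞ where
  contMDiff :=
    { contMDiff := by
        intro σ hσ
        have hσ' := contMDiffOn_univ.1 hσ
        have h1 := contMDiffOn_univ.1 (h.contMDiff.contMDiff hσ)
        have h2 := contMDiffOn_univ.1 (h.contMDiff.contMDiff
          (contMDiffOn_univ.2 (J.contMDiff.clm_bundle_apply hσ')))
        exact ((h1.sub_section (contMDiff_end_comp J.contMDiff h2)).const_smul_section).contMDiffOn }

theorem AffineConn.complexPart_torsionFree (h : nabla.torsion = 0)
    (hd : ∀ {X Y : (x : M) → TangentSpace I x} {x : M},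
      MDifferentiableAt I (I.prod 𝓘(ℝ, E))
        (fun y => (⟨y, X y⟩ : Bundle.TotalSpace E (TangentSpace I))) x →
      MDifferentiableAt I (I.prod 𝓘(ℝ, E))
        (fun y => (⟨y, Y y⟩ : Bundle.TotalSpace E (TangentSpace I))) x →
      nabla (fun y => J y (Y y)) x (X x) - nabla (fun y => J y (X y)) x (Y x)
        - J x (VectorField.mlieBracket I X Y x) = 0) :
    (nabla.complexPart J hJ).torsion = 0 := by
  refine (CovariantDerivative.torsion_eq_zero_iff _).2 ?_
  intro X Y x hX hY
  have h1 := (CovariantDerivative.torsion_eq_zero_iff _).1 h hX hY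
  have h2 := congrArg (J x) (sub_eq_zero.1 (hd hX hY))
  rw [hJ, map_sub] at h2
  rw [AffineConn.complexPart_apply, AffineConn.complexPart_apply]
  generalize VectorField.mlieBracket I X Y x = b at *
  rw [← smul_sub, show ∀ a b c d : TangentSpace I x, a - b - (c - d) = (a - c) - (b - d) from
    fun a b c d => by abel, h1, h2]
  module

theorem AffineConn.complexPart_parallelEnd :
    AffineConn.IsParallelEnd (nabla.complexPart J hJ) J := by
  intro X Y x
  have h : (fun y => J y (J y (Y y))) = (-1 : ℝ) • (fun y => Y y) := by
    ext1 y
    rw [hJ]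
    exact (neg_one_smul ℝ _).symm
  have h1 := nabla.isCovariantDerivativeOnUniv.smul_const (-1 : ℝ) (Y.mdifferentiableAt_mk x)
  rw [AffineConn.complexPart_apply, AffineConn.complexPart_apply, h, h1, map_smul, map_sub, hJ,
    smul_apply, map_smul]
  module

theorem AffineConn.complexPart_metric {g : SmoothBilinField I M}
    (gJ : ∀ (x : M) (u v : TangentSpace I x), g x (J x u) (J x v) = g x u v)
    (hω : AffineConn.IsParallelBilin nabla (fun x u v => g x u (J x v))) :
    AffineConn.IsParallelBilin (nabla.complexPart J hJ) (fun x u v => g x u v) := by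
  intro X Y Z x
  have gJ' : ∀ u v : TangentSpace I x, g x u (J x v) = - g x (J x u) v := by
    intro u v
    rw [← gJ x u (J x v), hJ, map_neg]
  have h1 := hω X Y (J.applyField Z) x
  have h2 := hω X (J.applyField Y) Z x
  have e1 : (fun y => g y (Y y) (J y (J.applyField Z y))) = fun y => - g y (Y y) (Z y) := by
    ext1 y
    exact (congrArg _ (hJ y _)).trans (map_neg _ _)
  have e2 : (fun y => g y (J.applyField Y y) (J y (Z y))) = fun y => g y (Y y) (Z y) := by
    ext1 y
    exact gJ y _ _
  rw [e1, mvfderiv_fun_neg] at h1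
  rw [e2] at h2
  have h3 : ∀ u, g x u (J x (J.applyField Z x)) = - g x u (Z x) := by
    intro u
    exact (congrArg _ (hJ x _)).trans (map_neg _ _)
  have h4 : ∀ u, g x (J.applyField Y x) (J x u) = g x (Y x) u := fun u => gJ x _ _
  beta_reduce at h1 h2 ⊢
  rw [h3] at h1
  rw [h4] at h2
  simp only [AffineConn.complexPart_apply, map_smul, map_sub, sub_apply, smul_apply, smul_eq_mul]
  have h5 := gJ' (nabla (J.applyField Y) x (X x)) (Z x)
  rw [h5] at h2
  have h6 : ((-mvfderiv I (fun y => g y (Y y) (Z y)) x) (X x) : ℝ) =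
    - mvfderiv I (fun y => g y (Y y) (Z y)) x (X x) := rfl
  rw [h6] at h1
  change _ = _ + g x (Y x) (J x (nabla (fun y => J y (Z y)) x (X x))) at h1
  change _ = - g x (J x (nabla (fun y => J y (Y y)) x (X x))) (Z x) + _ at h2
  linarith

end

end HalfConnection

section SymplecticAlgebra

variable {m : ℕ}

theorem sympForm_smul_left {R : Type*} [CommRing R] (c : R) (u v : Fin m ⊕ Fin m → R) :
    sympForm (c • u) v = c * sympForm u v := by
  simp only [sympForm, Finset.mul_sum, Pi.smul_apply, smul_eq_mul]
  exact Finset.sum_congr rfl fun i _ => by ring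

theorem sympForm_smul_right {R : Type*} [CommRing R] (c : R) (u v : Fin m ⊕ Fin m → R) :
    sympForm u (c • v) = c * sympForm u v := by
  simp only [sympForm, Finset.mul_sum, Pi.smul_apply, smul_eq_mul]
  exact Finset.sum_congr rfl fun i _ => by ring

theorem sympForm_swap {R : Type*} [CommRing R] (u v : Fin m ⊕ Fin m → R) :
    sympForm v u = - sympForm u v := by
  simp only [sympForm, ← Finset.sum_neg_distrib]
  exact Finset.sum_congr rfl fun i _ => by ring

theorem conj_sympForm (u v : CSymp m) :
    (starRingEnd ℂ) (sympForm u v) = sympForm (star u) (star v) := by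
  simp [sympForm]

theorem hermForm_eq (u v : CSymp m) : hermForm u v = Complex.I * sympForm u (star v) := rfl

theorem conj_hermForm (u v : CSymp m) : (starRingEnd ℂ) (hermForm u v) = hermForm v u := by
  rw [hermForm_eq, hermForm_eq, map_mul, conj_sympForm, star_star, Complex.conj_I,
    sympForm_swap v (star u)]
  ring

theorem hermForm_add_left (u u' v : CSymp m) :
    hermForm (u + u') v = hermForm u v + hermForm u' v := by
  rw [hermForm_eq, sympForm_add_left, mul_add]
  rfl

theorem hermForm_add_right (u v v' : CSymp m) :
    hermForm u (v + v') = hermForm u v + hermForm u v' := by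
  rw [hermForm_eq, star_add, sympForm_add_right, mul_add]
  rfl

theorem hermForm_smul_left (c : ℂ) (u v : CSymp m) : hermForm (c • u) v = c * hermForm u v := by
  rw [hermForm_eq, hermForm_eq, sympForm_smul_left]
  ring

theorem hermForm_smul_right (c : ℂ) (u v : CSymp m) :
    hermForm u (c • v) = (starRingEnd ℂ) c * hermForm u v := by
  rw [hermForm_eq, hermForm_eq, star_smul, sympForm_smul_right, starRingEnd_apply]
  ring

/-- The real part of the Hermitian form `γ`. -/
def hermFormRe (m : ℕ) : CSymp m →L[ℝ] CSymp m →L[ℝ] ℝ :=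
  (LinearMap.mk₂ ℝ (fun u v : CSymp m => (hermForm u v).re)
    (fun u u' v => by rw [hermForm_add_left, Complex.add_re])
    (fun c u v => by
      rw [show c • u = (c : ℂ) • u from rfl, hermForm_smul_left, Complex.re_ofReal_mul,
        smul_eq_mul])
    (fun u v v' => by rw [hermForm_add_right, Complex.add_re])
    (fun c u v => by
      rw [show c • v = (c : ℂ) • v from rfl, hermForm_smul_right, Complex.conj_ofReal,
        Complex.re_ofReal_mul, smul_eq_mul])).toContinuousBilinearMap

/-- Twice the real symplectic form. -/
def twiceSympForm (m : ℕ) : (Fin m ⊕ Fin m → ℝ) →L[ℝ] (Fin m ⊕ Fin m → ℝ) →L[ℝ] ℝ :=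
  (LinearMap.mk₂ ℝ (fun u v : Fin m ⊕ Fin m → ℝ => 2 * sympForm u v)
    (fun u u' v => by rw [sympForm_add_left, mul_add])
    (fun c u v => by rw [sympForm_smul_left, smul_eq_mul]; ring)
    (fun u v v' => by rw [sympForm_add_right, mul_add])
    (fun c u v => by rw [sympForm_smul_right, smul_eq_mul]; ring)).toContinuousBilinearMap

theorem twiceSympForm_apply (u v : Fin m ⊕ Fin m → ℝ) :
    twiceSympForm m u v = 2 * sympForm u v := rfl

/-- The real part `ℂ^{2m} → ℝ^{2m}`. -/
def rePart (m : ℕ) : CSymp m →L[ℝ] (Fin m ⊕ Fin m → ℝ) :=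
  ContinuousLinearMap.pi fun j => Complex.reCLM ∘L ContinuousLinearMap.proj j

/-- The imaginary part `ℂ^{2m} → ℝ^{2m}`. -/
def imPart (m : ℕ) : CSymp m →L[ℝ] (Fin m ⊕ Fin m → ℝ) :=
  ContinuousLinearMap.pi fun j => Complex.imCLM ∘L ContinuousLinearMap.proj j

@[simp] theorem rePart_apply (u : CSymp m) (j : Fin m ⊕ Fin m) : rePart m u j = (u j).re := rfl

@[simp] theorem imPart_apply (u : CSymp m) (j : Fin m ⊕ Fin m) : imPart m u j = (u j).im := rfl

theorem rePart_I_smul (u : CSymp m) : rePart m (Complex.I • u) = - imPart m u := by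
  ext j
  simp

theorem imPart_I_smul (u : CSymp m) : imPart m (Complex.I • u) = rePart m u := by
  ext j
  simp

theorem star_eq_self_of_imPart_eq_zero {u : CSymp m} (h : imPart m u = 0) : star u = u := by
  ext j
  exact Complex.conj_eq_iff_im.2 (congrFun h j)

/-- On a Lagrangian subspace, `Re γ(u, √-1 v)` is twice the symplectic form of the real parts. -/
theorem re_hermForm_I_smul_right {u v : CSymp m} (h : sympForm u v = 0) :
    (hermForm u (Complex.I • v)).re = 2 * sympForm (rePart m u) (rePart m v) := by
  have h1 : hermForm u (Complex.I • v) = sympForm u (star v) := by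
    rw [hermForm_smul_right, hermForm_eq, Complex.conj_I]
    linear_combination (-sympForm u (star v)) * Complex.I_mul_I
  have h2 := congrArg Complex.re h
  rw [h1]
  simp only [sympForm, Complex.re_sum, Complex.sub_re, Complex.mul_re, Complex.zero_re,
    Pi.star_apply, RCLike.star_def, Complex.conj_re, Complex.conj_im, rePart_apply,
    Finset.mul_sum] at h2 ⊢
  refine Eq.trans ?_ (sub_zero _)
  rw [← h2, ← Finset.sum_sub_distrib]
  exact Finset.sum_congr rfl fun i _ => by ring

theorem rePart_comp_injective {T : Type*} [AddCommGroup T] [Module ℝ T] (P : T →ₗ[ℝ] CSymp m)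
    (j : T → T) (hj : ∀ u, P (j u) = Complex.I • P u)
    (lagrangian : ∀ u v, sympForm (P u) (P v) = 0)
    (kahlerian : ∀ u, (∀ v, hermForm (P u) (P v) = 0) → u = 0) :
    Function.Injective (fun u => rePart m (P u)) := by
  have hker : ∀ u, rePart m (P u) = 0 → u = 0 := by
    intro u hu
    have h1 : star (P (j u)) = P (j u) := by
      apply star_eq_self_of_imPart_eq_zero
      rw [hj, imPart_I_smul, hu]
    have h2 : j u = 0 := by
      apply kahlerian
      intro v
      rw [← conj_hermForm, hermForm_eq, h1, lagrangian, mul_zero, map_zero]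
    have h3 : P u = 0 := by
      have := hj u
      rw [h2, map_zero] at this
      exact (smul_eq_zero.1 this.symm).resolve_left Complex.I_ne_zero
    apply kahlerian
    intro v
    rw [h3, hermForm_eq, sympForm_zero_left, mul_zero]
  intro u v huv
  rw [← sub_eq_zero]
  apply hker
  simp only [map_sub] at huv ⊢
  exact sub_eq_zero.2 huv

end SymplecticAlgebra

section Induced

variable {E : Type*} [NormedAddCommGroup E] [NormedSpace ℝ E] [FiniteDimensional ℝ E]
  {H : Type*} [TopologicalSpace H] {I : ModelWithCorners ℝ E H}
  {M : Type*} [TopologicalSpace M] [ChartedSpace H M] [IsManifold I ∞ M] {m : ℕ}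

/-- The real part of a map into `ℂ^{2m}`. -/
def reMap (φ : M → CSymp m) (x : M) : Fin m ⊕ Fin m → ℝ := rePart m (φ x)

theorem contMDiff_reMap {φ : M → CSymp m} (hφ : ContMDiff I 𝓘(ℝ, CSymp m) ∞ φ) :
    ContMDiff I 𝓘(ℝ, Fin m ⊕ Fin m → ℝ) ∞ (reMap φ) :=
  (rePart m).contMDiff.comp hφ

theorem mvfderiv_reMap {φ : M → CSymp m} (hφ : ContMDiff I 𝓘(ℝ, CSymp m) ∞ φ) (x : M)
    (u : TangentSpace I x) : mvfderiv I (reMap φ) x u = rePart m (mvfderiv I φ x u) := by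
  have := mvfderiv_clm_comp (rePart m) ((hφ x).mdifferentiableAt (by simp))
  exact DFunLike.congr_fun this u

theorem isInvertible_mvfderiv_reMap {φ : M → CSymp m} (hφ : ContMDiff I 𝓘(ℝ, CSymp m) ∞ φ)
    (dim : Module.finrank ℝ E = 2 * m) {j : (x : M) → TangentSpace I x → TangentSpace I x}
    (hj : ∀ x u, mvfderiv I φ x (j x u) = Complex.I • mvfderiv I φ x u)
    (lagrangian : ∀ (x : M) (u v : TangentSpace I x),
      sympForm (mvfderiv I φ x u) (mvfderiv I φ x v) = 0)
    (kahlerian : IsKahlerianMap I φ) (x : M) : (mvfderiv I (reMap φ) x).IsInvertible := by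
  have hinj : Function.Injective (mvfderiv I (reMap φ) x) := by
    have := rePart_comp_injective (mvfderiv I φ x).toLinearMap (j x) (hj x) (lagrangian x)
      (kahlerian x)
    intro u v huv
    rw [mvfderiv_reMap hφ, mvfderiv_reMap hφ] at huv
    exact this huv
  have : FiniteDimensional ℝ (TangentSpace I x) := inferInstanceAs (FiniteDimensional ℝ E)
  have : T2Space (TangentSpace I x) := inferInstanceAs (T2Space E)
  have hd : Module.finrank ℝ (TangentSpace I x) = Module.finrank ℝ (Fin m ⊕ Fin m → ℝ) := by
    rw [show Module.finrank ℝ (TangentSpace I x) = Module.finrank ℝ E from rfl, dim]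
    simp [two_mul]
  refine ⟨(LinearEquiv.ofInjectiveOfFinrankEq (mvfderiv I (reMap φ) x).toLinearMap hinj
    hd).toContinuousLinearEquiv, ?_⟩
  ext1 u
  rfl

end Induced

section Induced

variable {E : Type*} [NormedAddCommGroup E] [NormedSpace ℝ E] [FiniteDimensional ℝ E]
  {H : Type*} [TopologicalSpace H] {I : ModelWithCorners ℝ E H}
  {M : Type*} [TopologicalSpace M] [ChartedSpace H M] [IsManifold I ∞ M] {m : ℕ}

theorem contMDiff_const_smul_CSymp (c : ℂ) {φ : M → CSymp m}
    (hφ : ContMDiff I 𝓘(ℝ, CSymp m) ∞ φ) :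
    ContMDiff I 𝓘(ℝ, CSymp m) ∞ (fun x => c • φ x) :=
  ((c • ContinuousLinearMap.id ℂ (CSymp m)).restrictScalars ℝ).contMDiff.comp hφ

theorem mvfderiv_const_smul_CSymp (c : ℂ) {φ : M → CSymp m}
    (hφ : ContMDiff I 𝓘(ℝ, CSymp m) ∞ φ) (x : M) (u : TangentSpace I x) :
    mvfderiv I (fun x => c • φ x) x u = c • mvfderiv I φ x u :=
  DFunLike.congr_fun (mvfderiv_clm_comp
    ((c • ContinuousLinearMap.id ℂ (CSymp m)).restrictScalars ℝ)
    ((hφ x).mdifferentiableAt (by simp))) u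

theorem mvfderiv_reMap_of_holomorphic {φ : M → CSymp m} (hφ : ContMDiff I 𝓘(ℝ, CSymp m) ∞ φ)
    {x : M} {u v : TangentSpace I x} (h : mvfderiv I φ x v = Complex.I • mvfderiv I φ x u) :
    mvfderiv I (reMap φ) x v = mvfderiv I (reMap fun x => Complex.I • φ x) x u := by
  rw [mvfderiv_reMap hφ, mvfderiv_reMap (contMDiff_const_smul_CSymp _ hφ),
    mvfderiv_const_smul_CSymp _ hφ, h]

/-- The almost complex structure for which a Kählerian Lagrangian immersion is holomorphic is
smooth. -/
theorem contMDiff_end_of_holomorphic {φ : M → CSymp m} (hφ : ContMDiff I 𝓘(ℝ, CSymp m) ∞ φ)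
    (hinv : ∀ x, (mvfderiv I (reMap φ) x).IsInvertible)
    {j : (x : M) → TangentSpace I x →L[ℝ] TangentSpace I x}
    (hj : ∀ x u, mvfderiv I φ x (j x u) = Complex.I • mvfderiv I φ x u) :
    ContMDiff I (I.prod 𝓘(ℝ, E →L[ℝ] E)) ∞
      (fun x => (⟨x, j x⟩ : Bundle.TotalSpace (E →L[ℝ] E)
        fun x : M => TangentSpace I x →L[ℝ] TangentSpace I x)) := by
  intro x₀
  refine contMDiffAt_end_section_of_mvfderiv_comp (contMDiff_reMap hφ) hinv ?_
  refine (contMDiffAt_mvfderiv_comp_symmL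
    (contMDiff_reMap (contMDiff_const_smul_CSymp Complex.I hφ)) x₀).congr_of_eventuallyEq ?_
  filter_upwards with x
  ext1 u
  exact mvfderiv_reMap_of_holomorphic hφ (hj x _)

namespace IsKahlerianLagrangianImmersion

variable {J : SmoothEndField I M} {φ : M → CSymp m} (h : IsKahlerianLagrangianImmersion J φ)

include h

theorem isInvertible (x : M) : (mvfderiv I (reMap φ) x).IsInvertible :=
  isInvertible_mvfderiv_reMap h.smooth h.dim h.holomorphic h.lagrangian h.kahlerian x

theorem mvfderiv_reMap_J (x : M) (u : TangentSpace I x) :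
    mvfderiv I (reMap φ) x (J x u) = mvfderiv I (reMap fun x => Complex.I • φ x) x u :=
  mvfderiv_reMap_of_holomorphic h.smooth (h.holomorphic x u)

theorem J_sq (x : M) (u : TangentSpace I x) : J x (J x u) = -u := by
  apply h.immersion x
  rw [h.holomorphic, h.holomorphic, smul_smul, Complex.I_mul_I, map_neg, neg_one_smul]

omit h in
/-- The metric `Re φ^* γ`. -/
def inducedMetric (h : IsKahlerianLagrangianImmersion J φ) : SmoothBilinField I M :=
  ⟨fun x => pullbackBilin (hermFormRe m) (mvfderiv I φ x),
    contMDiff_pullbackBilin_section (hermFormRe m) h.smooth⟩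

theorem inducedMetric_apply (x : M) (u v : TangentSpace I x) :
    h.inducedMetric x u v = (hermForm (mvfderiv I φ x u) (mvfderiv I φ x v)).re := rfl

omit h in
/-- The connection for which the real parts of the components of `φ` are affine. -/
def inducedConn (h : IsKahlerianLagrangianImmersion J φ) : AffineConn I M :=
  frameConn (reMap φ) (contMDiff_reMap h.smooth) h.isInvertible

theorem mvfderiv_inducedConn (σ : (x : M) → TangentSpace I x) (x : M) (u : TangentSpace I x) :
    mvfderiv I (reMap φ) x (h.inducedConn σ x u) =
      mvfderiv I (fun y => mvfderiv I (reMap φ) y (σ y)) x u :=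
  mvfderiv_frameConn _ _ σ x u

theorem inducedConn_d_J [I.Boundaryless] {X Y : (x : M) → TangentSpace I x} {x : M}
    (hX : MDifferentiableAt I (I.prod 𝓘(ℝ, E))
      (fun y => (⟨y, X y⟩ : Bundle.TotalSpace E (TangentSpace I))) x)
    (hY : MDifferentiableAt I (I.prod 𝓘(ℝ, E))
      (fun y => (⟨y, Y y⟩ : Bundle.TotalSpace E (TangentSpace I))) x) :
    h.inducedConn (fun y => J y (Y y)) x (X x) - h.inducedConn (fun y => J y (X y)) x (Y x)
      - J x (VectorField.mlieBracket I X Y x) = 0 := by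
  apply (h.isInvertible x).injective
  rw [map_zero, map_sub, map_sub, h.mvfderiv_inducedConn, h.mvfderiv_inducedConn,
    h.mvfderiv_reMap_J, mvfderiv_mlieBracket
      (contMDiff_reMap (contMDiff_const_smul_CSymp Complex.I h.smooth)) hX hY]
  simp only [h.mvfderiv_reMap_J, sub_self]

theorem inducedMetric_nondeg (x : M) (u : TangentSpace I x)
    (hu : ∀ v : TangentSpace I x, h.inducedMetric x u v = 0) : u = 0 := by
  apply h.kahlerian
  intro v
  have h1 := hu v
  have h2 := hu (J x v)
  rw [inducedMetric_apply] at h1 h2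
  rw [h.holomorphic, hermForm_smul_right, Complex.conj_I] at h2
  apply Complex.ext h1
  simpa using h2

theorem inducedMetric_J (x : M) (u v : TangentSpace I x) :
    h.inducedMetric x (J x u) (J x v) = h.inducedMetric x u v := by
  rw [inducedMetric_apply, inducedMetric_apply, h.holomorphic, h.holomorphic, hermForm_smul_left,
    hermForm_smul_right, Complex.conj_I, ← mul_assoc]
  simp

theorem inducedConn_omega :
    AffineConn.IsParallelBilin h.inducedConn (fun x u v => h.inducedMetric x u (J x v)) := by
  refine frameConn_parallelBilin _ _ (twiceSympForm m) fun x u v => ?_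
  rw [inducedMetric_apply, h.holomorphic, re_hermForm_I_smul_right (h.lagrangian x u v),
    mvfderiv_reMap h.smooth, mvfderiv_reMap h.smooth, twiceSympForm_apply]

theorem complexPart_isLeviCivita [I.Boundaryless] :
    IsLeviCivita (h.inducedConn.complexPart J h.J_sq) h.inducedMetric where
  smooth := AffineConn.complexPart_smooth (frameConn_smooth _ _)
  torsionFree := AffineConn.complexPart_torsionFree (frameConn_torsionFree _ _) h.inducedConn_d_J
  metric := AffineConn.complexPart_metric h.inducedMetric_J h.inducedConn_omega

omit h in
/-- The affine special Kähler structure induced by a Kählerian Lagrangian immersion. -/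
def inducedStructure [I.Boundaryless] (h : IsKahlerianLagrangianImmersion J φ) :
    AffineSpecialKahler I M where
  J := J
  g := h.inducedMetric
  nabla := h.inducedConn
  pseudoKahler :=
    { J_sq := h.J_sq
      g_symm := fun x u v => by
        rw [inducedMetric_apply, inducedMetric_apply, ← conj_hermForm, Complex.conj_re]
      g_nondeg := h.inducedMetric_nondeg
      g_J := h.inducedMetric_J
      parallel_J := ⟨_, h.complexPart_isLeviCivita, AffineConn.complexPart_parallelEnd⟩ }
  nabla_smooth := frameConn_smooth _ _
  nabla_flat := frameConn_flat _ _
  nabla_torsionFree := frameConn_torsionFree _ _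
  nabla_omega := h.inducedConn_omega
  d_nabla_J := fun X Y x => h.inducedConn_d_J (X.mdifferentiableAt_mk x) (Y.mdifferentiableAt_mk x)

end IsKahlerianLagrangianImmersion

theorem mvfderiv_re_component {φ : M → CSymp m} (hφ : ContMDiff I 𝓘(ℝ, CSymp m) ∞ φ) (x : M)
    (u : TangentSpace I x) (j : Fin m ⊕ Fin m) :
    mvfderiv I (fun y => (φ y j).re) x u = mvfderiv I (reMap φ) x u j :=
  DFunLike.congr_fun (mvfderiv_clm_comp (ContinuousLinearMap.proj (R := ℝ) j)
    ((contMDiff_reMap hφ x).mdifferentiableAt (by simp))) u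

/-- The real parts of the components of `φ` are affine for `∇` if and only if `Re φ`, as a
vector-valued function, is. -/
theorem connection_iff {φ : M → CSymp m} (hφ : ContMDiff I 𝓘(ℝ, CSymp m) ∞ φ)
    (Y : SmoothVectorField I M) (x : M) (u w : TangentSpace I x) :
    (∀ j, mvfderiv I (fun y => (φ y j).re) x w
      = mvfderiv I (fun y => mvfderiv I (fun y' => (φ y' j).re) y (Y y)) x u) ↔
    mvfderiv I (reMap φ) x w = mvfderiv I (fun y => mvfderiv I (reMap φ) y (Y y)) x u := by
  have h1 : ∀ j, mvfderiv I (fun y => mvfderiv I (fun y' => (φ y' j).re) y (Y y)) x u =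
      mvfderiv I (fun y => mvfderiv I (reMap φ) y (Y y)) x u j := by
    intro j
    have h2 : (fun y => mvfderiv I (fun y' => (φ y' j).re) y (Y y)) =
        fun y => ContinuousLinearMap.proj (R := ℝ) (φ := fun _ : Fin m ⊕ Fin m => ℝ) j
          (mvfderiv I (reMap φ) y (Y y)) :=
      funext fun y => mvfderiv_re_component hφ y (Y y) j
    have h3 : MDifferentiableAt I 𝓘(ℝ, Fin m ⊕ Fin m → ℝ)
        (fun y => mvfderiv I (reMap φ) y (Y y)) x :=
      mdifferentiableAt_mvfderiv_apply (contMDiff_reMap hφ) (Y.mdifferentiableAt_mk x)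
    rw [h2, mvfderiv_clm_comp _ h3]
    rfl
  rw [funext_iff]
  refine forall_congr' fun j => ?_
  rw [h1, mvfderiv_re_component hφ]

namespace IsKahlerianLagrangianImmersion

variable {J : SmoothEndField I M} {φ : M → CSymp m} (h : IsKahlerianLagrangianImmersion J φ)

theorem inducedStructure_induces [I.Boundaryless] : InducesASK φ h.inducedStructure where
  immersion := h
  metric := h.inducedMetric_apply
  connection := fun Y x u => (connection_iff h.smooth Y x u _).2 (h.mvfderiv_inducedConn Y x u)

section Conical

variable {xi : SmoothVectorField I M} (hxi : ∀ x, mvfderiv I φ x (xi x) = φ x)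

include hxi

theorem inducedConn_xi (x : M) (u : TangentSpace I x) : h.inducedConn xi x u = u := by
  apply (h.isInvertible x).injective
  rw [h.mvfderiv_inducedConn]
  simp only [mvfderiv_reMap h.smooth _ (xi _), hxi]
  rfl

theorem inducedConn_J_xi (x : M) (u : TangentSpace I x) :
    h.inducedConn (fun y => J y (xi y)) x u = J x u := by
  apply (h.isInvertible x).injective
  rw [h.mvfderiv_inducedConn, h.mvfderiv_reMap_J]
  simp only [mvfderiv_reMap h.smooth _ (J _ _), h.holomorphic, hxi]
  rfl

omit hxi in
/-- The conical affine special Kähler structure induced by a homogeneous immersion. -/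
def inducedConicalStructure [I.Boundaryless] (hxi : ∀ x, mvfderiv I φ x (xi x) = φ x)
    (hne : ∀ x, hermForm (φ x) (φ x) ≠ 0) : ConicalAffineSpecialKahler I M where
  toAffineSpecialKahler := h.inducedStructure
  xi := xi
  g_xi := fun x h0 => by
    apply hne x
    have h1 := h.inducedMetric_apply x (xi x) (xi x)
    rw [hxi] at h1
    refine Complex.ext (h1.symm.trans h0) ?_
    exact Complex.conj_eq_iff_im.1 (conj_hermForm (φ x) (φ x))
  nabla_xi := h.inducedConn_xi hxi
  leviCivita_xi := ⟨_, h.complexPart_isLeviCivita, fun x u => by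
    rw [AffineConn.complexPart_apply, h.inducedConn_xi hxi, h.inducedConn_J_xi hxi, h.J_sq]
    module⟩

end Conical

end IsKahlerianLagrangianImmersion

end Induced

section ConificationAlgebra

variable {n : ℕ}

/-- The vector of `ℂ^{2n+2} = ℂ^2 × ℂ^{2n}` with components `(a, b)` and `v`. -/
def conVec (n : ℕ) : (ℂ × ℂ × CSymp n) →ₗ[ℂ] CSymp (n + 1) where
  toFun t := Sum.elim (Fin.cons t.1 fun i => t.2.2 (Sum.inl i))
    (Fin.cons t.2.1 fun i => t.2.2 (Sum.inr i))
  map_add' s t := by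
    ext j
    rcases j with j | j <;> refine Fin.cases ?_ (fun i => ?_) j <;> simp
  map_smul' c t := by
    ext j
    rcases j with j | j <;> refine Fin.cases ?_ (fun i => ?_) j <;> simp

theorem conVec_apply (a b : ℂ) (v : CSymp n) : conVec n (a, b, v) =
    Sum.elim (Fin.cons a fun i => v (Sum.inl i)) (Fin.cons b fun i => v (Sum.inr i)) := rfl

theorem sympForm_conVec (a b a' b' : ℂ) (v v' : CSymp n) :
    sympForm (conVec n (a, b, v)) (conVec n (a', b', v')) = a * b' - b * a' + sympForm v v' := by
  rw [conVec_apply, conVec_apply, sympForm, Fin.sum_univ_succ]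
  simp [sympForm]

theorem star_conVec (a b : ℂ) (v : CSymp n) :
    star (conVec n (a, b, v)) = conVec n (star a, star b, star v) := by
  ext j
  rw [conVec_apply, conVec_apply]
  rcases j with j | j <;> refine Fin.cases ?_ (fun i => ?_) j <;> simp

/-- `conVec` as a continuous real linear map. -/
def conVecL (n : ℕ) : (ℂ × ℂ × CSymp n) →L[ℝ] CSymp (n + 1) :=
  (conVec n).toContinuousLinearMap.restrictScalars ℝ

theorem conVecL_apply (t : ℂ × ℂ × CSymp n) : conVecL n t = conVec n t := rfl

theorem contDiff_pairingZW : ContDiff ℝ ∞ (pairingZW : CSymp n → ℂ) := by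
  unfold pairingZW
  fun_prop

theorem fderiv_pairingZW (u v : CSymp n) : fderiv ℝ pairingZW u v =
    ∑ i, (u (Sum.inl i) * v (Sum.inr i) + u (Sum.inr i) * v (Sum.inl i)) := by
  have h : ∀ i : Fin n, HasFDerivAt (𝕜 := ℝ)
      (fun u : CSymp n => u (Sum.inl i) * u (Sum.inr i)) _ u :=
    fun i => (hasFDerivAt_apply (𝕜 := ℝ) (Sum.inl i) u).mul (hasFDerivAt_apply (Sum.inr i) u)
  have h2 : HasFDerivAt (𝕜 := ℝ) (pairingZW : CSymp n → ℂ) _ u :=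
    HasFDerivAt.fun_sum (u := Finset.univ) fun i _ => h i
  rw [h2.fderiv]
  simp

end ConificationAlgebra

section Conification

variable {E : Type*} [NormedAddCommGroup E] [NormedSpace ℝ E] [FiniteDimensional ℝ E]
  {H : Type*} [TopologicalSpace H] {I : ModelWithCorners ℝ E H}
  {M : Type*} [TopologicalSpace M] [ChartedSpace H M] [IsManifold I ∞ M]

theorem contMDiff_val_fst :
    ContMDiff (𝓘(ℝ, ℂ).prod I) 𝓘(ℝ, ℂ) ∞ (fun q : ℂˣ × M => (q.1 : ℂ)) :=
  Units.contMDiff_val.comp contMDiff_fst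

theorem mvfderiv_val_fst (q : ℂˣ × M) (u : TangentSpace (𝓘(ℝ, ℂ).prod I) q) :
    mvfderiv (𝓘(ℝ, ℂ).prod I) (fun q' : ℂˣ × M => (q'.1 : ℂ)) q u = (u : ℂ × E).1 := by
  have h1 : mfderiv 𝓘(ℝ, ℂ) 𝓘(ℝ, ℂ) (Units.val : ℂˣ → ℂ) q.1 = ContinuousLinearMap.id ℝ _ :=
    mfderiv_extChartAt_self (I := 𝓘(ℝ, ℂ)) (x := q.1)
  have h2 := mfderiv_comp q
    ((Units.contMDiff_val (R := ℂ) (𝕜 := ℝ) (n := ∞) q.1).mdifferentiableAt (by simp))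
    (mdifferentiableAt_fst (I := 𝓘(ℝ, ℂ)) (I' := I))
  rw [h1, mfderiv_fst] at h2
  exact DFunLike.congr_fun h2 u

theorem mfderiv_snd_apply (q : ℂˣ × M) (u : TangentSpace (𝓘(ℝ, ℂ).prod I) q) :
    mfderiv (𝓘(ℝ, ℂ).prod I) I (Prod.snd : ℂˣ × M → M) q u = (u : ℂ × E).2 := by
  rw [mfderiv_snd]
  rfl

theorem mvfderiv_comp_snd {W : Type*} [NormedAddCommGroup W] [NormedSpace ℝ W] {f : M → W}
    {q : ℂˣ × M} (hf : MDifferentiableAt I 𝓘(ℝ, W) f q.2)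
    (u : TangentSpace (𝓘(ℝ, ℂ).prod I) q) :
    mvfderiv (𝓘(ℝ, ℂ).prod I) (fun q : ℂˣ × M => f q.2) q u =
      mvfderiv I f q.2 (mfderiv (𝓘(ℝ, ℂ).prod I) I (Prod.snd : ℂˣ × M → M) q u) :=
  DFunLike.congr_fun (mfderiv_comp q hf (mdifferentiableAt_snd (I := 𝓘(ℝ, ℂ)) (I' := I))) u

/-- Tangent vectors of `ℂ^* × M` are determined by their projections. -/
theorem tangent_prod_ext {q : ℂˣ × M} {u v : TangentSpace (𝓘(ℝ, ℂ).prod I) q}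
    (h1 : mvfderiv (𝓘(ℝ, ℂ).prod I) (fun q' : ℂˣ × M => (q'.1 : ℂ)) q u =
      mvfderiv (𝓘(ℝ, ℂ).prod I) (fun q' : ℂˣ × M => (q'.1 : ℂ)) q v)
    (h2 : mfderiv (𝓘(ℝ, ℂ).prod I) I (Prod.snd : ℂˣ × M → M) q u =
      mfderiv (𝓘(ℝ, ℂ).prod I) I (Prod.snd : ℂˣ × M → M) q v) : u = v := by
  rw [mvfderiv_val_fst, mvfderiv_val_fst] at h1
  rw [mfderiv_snd_apply, mfderiv_snd_apply] at h2
  exact Prod.ext h1 h2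

/-- The product complex structure of `ℂ^* × M`. -/
def prodComplex (J : SmoothEndField I M) (q : ℂˣ × M) :
    TangentSpace (𝓘(ℝ, ℂ).prod I) q →L[ℝ] TangentSpace (𝓘(ℝ, ℂ).prod I) q :=
  (((Complex.I • ContinuousLinearMap.id ℂ ℂ).restrictScalars ℝ).prodMap (J q.2 : E →L[ℝ] E) :
    ℂ × E →L[ℝ] ℂ × E)

theorem mvfderiv_val_prodComplex (J : SmoothEndField I M) (q : ℂˣ × M)
    (u : TangentSpace (𝓘(ℝ, ℂ).prod I) q) :
    mvfderiv (𝓘(ℝ, ℂ).prod I) (fun q' : ℂˣ × M => (q'.1 : ℂ)) q (prodComplex J q u) =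
      Complex.I * mvfderiv (𝓘(ℝ, ℂ).prod I) (fun q' : ℂˣ × M => (q'.1 : ℂ)) q u := by
  rw [mvfderiv_val_fst, mvfderiv_val_fst]
  rfl

theorem mfderiv_snd_prodComplex (J : SmoothEndField I M) (q : ℂˣ × M)
    (u : TangentSpace (𝓘(ℝ, ℂ).prod I) q) :
    mfderiv (𝓘(ℝ, ℂ).prod I) I (Prod.snd : ℂˣ × M → M) q (prodComplex J q u) =
      J q.2 (mfderiv (𝓘(ℝ, ℂ).prod I) I (Prod.snd : ℂˣ × M → M) q u) := by
  rw [mfderiv_snd_apply, mfderiv_snd_apply]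
  rfl

namespace IsSpecialKahlerPair

variable {n : ℕ} {S : AffineSpecialKahler I M} {p : ImmersionPair M n}
  (hp : IsSpecialKahlerPair S p)

include hp

theorem contMDiff_w0 : ContMDiff I 𝓘(ℝ, ℂ) ∞ (fun x => 2 * p.F x - pairingZW (p.φ x)) := by
  have h1 : ContMDiff I 𝓘(ℝ, ℂ) ∞ (fun x => 2 * p.F x) :=
    ((2 : ℂ) • ContinuousLinearMap.id ℂ ℂ |>.restrictScalars ℝ).contMDiff.comp hp.smooth
  exact h1.sub (contDiff_pairingZW.contMDiff.comp hp.induces.immersion.smooth)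

/-- `d (2F - zᵗ w) = Ω(dφ, φ)`. -/
theorem mvfderiv_w0 (x : M) (u : TangentSpace I x) :
    mvfderiv I (fun x => 2 * p.F x - pairingZW (p.φ x)) x u =
      sympForm (mvfderiv I p.φ x u) (p.φ x) := by
  have hF := (hp.smooth x).mdifferentiableAt (by simp)
  have hφ := (hp.induces.immersion.smooth x).mdifferentiableAt (by simp)
  have h0 := contDiff_pairingZW.differentiable (by simp) (p.φ x)
  have h1 := mvfderiv_comp_differentiableAt h0 hφ
  have h2 := mvfderiv_clm_comp ((2 : ℂ) • ContinuousLinearMap.id ℂ ℂ |>.restrictScalars ℝ) hF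
  have h3 : MDifferentiableAt I 𝓘(ℝ, ℂ) (fun x => 2 * p.F x) x :=
    (((2 : ℂ) • ContinuousLinearMap.id ℂ ℂ |>.restrictScalars ℝ).differentiableAt
      (x := p.F x)).mdifferentiableAt.comp x hF
  have h4 : MDifferentiableAt I 𝓘(ℝ, ℂ) (fun x => pairingZW (p.φ x)) x :=
    h0.mdifferentiableAt.comp x hφ
  have h5 := DFunLike.congr_fun h2 u
  have h6 := DFunLike.congr_fun (mvfderiv_fun_sub h3 h4) u
  refine h6.trans ((congrArg₂ (· - ·) h5 (DFunLike.congr_fun h1 u)).trans ?_)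
  change 2 * mvfderiv I p.F x u - fderiv ℝ pairingZW (p.φ x) (mvfderiv I p.φ x u) = _
  rw [hp.prepotential, fderiv_pairingZW, sympForm, Finset.mul_sum, ← Finset.sum_sub_distrib]
  exact Finset.sum_congr rfl fun i _ => by ring

/-- The conification at `z⁰ = 1`. -/
theorem contMDiff_base : ContMDiff I 𝓘(ℝ, CSymp (n + 1)) ∞
    (fun x => conVecL n (1, 2 * p.F x - pairingZW (p.φ x), p.φ x)) :=
  (conVecL n).contMDiff.comp (contMDiff_const.prodMk_space
    (hp.contMDiff_w0.prodMk_space hp.induces.immersion.smooth))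

theorem mvfderiv_base (x : M) (u : TangentSpace I x) :
    mvfderiv I (fun x => conVecL n (1, 2 * p.F x - pairingZW (p.φ x), p.φ x)) x u =
      conVec n (0, sympForm (mvfderiv I p.φ x u) (p.φ x), mvfderiv I p.φ x u) := by
  have h1 := (hp.contMDiff_w0 x).mdifferentiableAt (by simp)
  have h2 := (hp.induces.immersion.smooth x).mdifferentiableAt (by simp)
  have h3 : MDifferentiableAt I 𝓘(ℝ, ℂ) (fun _ : M => (1 : ℂ)) x := mdifferentiableAt_const
  rw [mvfderiv_clm_comp (conVecL n) (h3.prodMk_space (h1.prodMk_space h2)),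
    mvfderiv_prodMk h3 (h1.prodMk_space h2), mvfderiv_prodMk h1 h2, mvfderiv_const]
  simp [hp.mvfderiv_w0, conVecL_apply]

omit hp in
theorem con_eq (q : ℂˣ × M) : p.con q =
    (q.1 : ℂ) • conVecL n (1, 2 * p.F q.2 - pairingZW (p.φ q.2), p.φ q.2) := rfl

theorem contMDiff_con : ContMDiff (𝓘(ℝ, ℂ).prod I) 𝓘(ℝ, CSymp (n + 1)) ∞ p.con :=
  ContMDiff.clm_apply ((ContinuousLinearMap.lsmul ℝ ℂ : ℂ →L[ℝ] CSymp (n + 1) →L[ℝ] _).contMDiff.comp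
    contMDiff_val_fst) (hp.contMDiff_base.comp contMDiff_snd)

/-- The differential of the conification. -/
theorem mvfderiv_con (q : ℂˣ × M) (u : TangentSpace (𝓘(ℝ, ℂ).prod I) q) :
    mvfderiv (𝓘(ℝ, ℂ).prod I) p.con q u =
      mvfderiv (𝓘(ℝ, ℂ).prod I) (fun q' : ℂˣ × M => (q'.1 : ℂ)) q u •
        conVec n (1, 2 * p.F q.2 - pairingZW (p.φ q.2), p.φ q.2) +
      (q.1 : ℂ) • conVec n (0, sympForm (mvfderiv I p.φ q.2
          (mfderiv (𝓘(ℝ, ℂ).prod I) I (Prod.snd : ℂˣ × M → M) q u)) (p.φ q.2),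
        mvfderiv I p.φ q.2 (mfderiv (𝓘(ℝ, ℂ).prod I) I (Prod.snd : ℂˣ × M → M) q u)) := by
  have h1 := (hp.contMDiff_base q.2).mdifferentiableAt (by simp)
  have h2 := mvfderiv_bilin (ContinuousLinearMap.lsmul ℝ ℂ : ℂ →L[ℝ] CSymp (n + 1) →L[ℝ] _)
    ((contMDiff_val_fst (I := I) (M := M) q).mdifferentiableAt (by simp))
    (((hp.contMDiff_base.comp contMDiff_snd) q).mdifferentiableAt (by simp)) u
  have h3 := mvfderiv_comp_snd h1 u
  rw [hp.mvfderiv_base] at h3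
  refine h2.trans ?_
  refine congrArg₂ _ rfl (congrArg _ h3)

theorem con_holomorphic (q : ℂˣ × M) (u : TangentSpace (𝓘(ℝ, ℂ).prod I) q) :
    mvfderiv (𝓘(ℝ, ℂ).prod I) p.con q (prodComplex S.J q u) =
      Complex.I • mvfderiv (𝓘(ℝ, ℂ).prod I) p.con q u := by
  rw [hp.mvfderiv_con, hp.mvfderiv_con, mvfderiv_val_prodComplex, mfderiv_snd_prodComplex,
    hp.induces.immersion.holomorphic, sympForm_smul_left, smul_add, smul_smul, smul_smul,
    mul_comm Complex.I (q.1 : ℂ), ← smul_smul (q.1 : ℂ)]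
  refine congrArg _ (congrArg _ ?_)
  rw [← (conVec n).map_smul, Prod.smul_mk, Prod.smul_mk, smul_zero, smul_eq_mul]

theorem con_lagrangian (q : ℂˣ × M) (u v : TangentSpace (𝓘(ℝ, ℂ).prod I) q) :
    sympForm (mvfderiv (𝓘(ℝ, ℂ).prod I) p.con q u)
      (mvfderiv (𝓘(ℝ, ℂ).prod I) p.con q v) = 0 := by
  rw [hp.mvfderiv_con, hp.mvfderiv_con]
  simp only [sympForm_add_left, sympForm_add_right, sympForm_smul_left, sympForm_smul_right,
    sympForm_conVec, hp.induces.immersion.lagrangian, sympForm_self]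
  rw [sympForm_swap (p.φ q.2) (mvfderiv I p.φ q.2 _), sympForm_swap (p.φ q.2) (mvfderiv I p.φ q.2 _)]
  ring

end IsSpecialKahlerPair

end Conification

section Conification

variable {E : Type*} [NormedAddCommGroup E] [NormedSpace ℝ E] [FiniteDimensional ℝ E]
  {H : Type*} [TopologicalSpace H] {I : ModelWithCorners ℝ E H}
  {M : Type*} [TopologicalSpace M] [ChartedSpace H M] [IsManifold I ∞ M]
  {n : ℕ} {S : AffineSpecialKahler I M} {p : ImmersionPair M n}

/-- The pointwise value of the vector field generating `e^t · (z⁰, p) = (e^t z⁰, p)`. -/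
def eulerVector (I : ModelWithCorners ℝ E H) (q : ℂˣ × M) :
    TangentSpace (𝓘(ℝ, ℂ).prod I) q :=
  (((q.1 : ℂ), (0 : E)) : ℂ × E)

theorem mvfderiv_val_eulerVector (q : ℂˣ × M) :
    mvfderiv (𝓘(ℝ, ℂ).prod I) (fun q' : ℂˣ × M => (q'.1 : ℂ)) q (eulerVector I q) = (q.1 : ℂ) := by
  rw [mvfderiv_val_fst]
  rfl

theorem mfderiv_snd_eulerVector (q : ℂˣ × M) :
    mfderiv (𝓘(ℝ, ℂ).prod I) I (Prod.snd : ℂˣ × M → M) q (eulerVector I q) = 0 := by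
  rw [mfderiv_snd_apply]
  rfl

namespace IsSpecialKahlerPair

variable (hp : IsSpecialKahlerPair S p) (hnd : p.IsNondegenerate I)

theorem mvfderiv_con_eulerVector (hp : IsSpecialKahlerPair S p) (q : ℂˣ × M) :
    mvfderiv (𝓘(ℝ, ℂ).prod I) p.con q (eulerVector I q) = p.con q := by
  rw [hp.mvfderiv_con, mvfderiv_val_eulerVector, mfderiv_snd_eulerVector, map_zero,
    sympForm_zero_left, con_eq, show ((0 : ℂ), (0 : ℂ), (0 : CSymp n)) = 0 from rfl, map_zero,
    smul_zero, add_zero]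
  rfl

theorem finrank_prod (hp : IsSpecialKahlerPair S p) : Module.finrank ℝ (ℂ × E) = 2 * (n + 1) := by
  rw [Module.finrank_prod, Complex.finrank_real_complex, hp.induces.immersion.dim]
  ring

include hp hnd

theorem con_isInvertible (q : ℂˣ × M) :
    (mvfderiv (𝓘(ℝ, ℂ).prod I) (reMap p.con) q).IsInvertible :=
  isInvertible_mvfderiv_reMap hp.contMDiff_con (hp.finrank_prod) hp.con_holomorphic
    hp.con_lagrangian hnd.kahlerian q

omit hp hnd in
/-- The product complex structure of `ℂ^* × M`, as a smooth field. -/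
def conComplex (hp : IsSpecialKahlerPair S p) (hnd : p.IsNondegenerate I) :
    SmoothEndField (𝓘(ℝ, ℂ).prod I) (ℂˣ × M) :=
  ⟨prodComplex S.J, contMDiff_end_of_holomorphic hp.contMDiff_con (hp.con_isInvertible hnd)
    hp.con_holomorphic⟩

omit hp hnd in
/-- The vector field generating `e^t · (z⁰, p) = (e^t z⁰, p)`, as a smooth field. -/
def eulerField (hp : IsSpecialKahlerPair S p) (hnd : p.IsNondegenerate I) :
    SmoothVectorField (𝓘(ℝ, ℂ).prod I) (ℂˣ × M) :=
  ⟨eulerVector I, contMDiff_section_of_mvfderiv_apply (contMDiff_reMap hp.contMDiff_con)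
    (hp.con_isInvertible hnd) (by
      simp only [mvfderiv_reMap hp.contMDiff_con, hp.mvfderiv_con_eulerVector]
      exact contMDiff_reMap hp.contMDiff_con)⟩

theorem con_immersion : IsKahlerianLagrangianImmersion (hp.conComplex hnd) p.con where
  dim := hp.finrank_prod
  smooth := hp.contMDiff_con
  holomorphic := hp.con_holomorphic
  immersion := fun q u v huv => by
    apply (hp.con_isInvertible hnd q).injective
    rw [mvfderiv_reMap hp.contMDiff_con, mvfderiv_reMap hp.contMDiff_con, huv]
  lagrangian := hp.con_lagrangian
  kahlerian := hnd.kahlerian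

theorem exists_conInduces [I.Boundaryless] :
    ∃ T : ConicalAffineSpecialKahler (𝓘(ℝ, ℂ).prod I) (ℂˣ × M), ConInduces S p T :=
  ⟨(hp.con_immersion hnd).inducedConicalStructure (xi := hp.eulerField hnd)
      hp.mvfderiv_con_eulerVector hnd.hermForm_ne,
    { induces := (hp.con_immersion hnd).inducedStructure_induces
      J_fst := mvfderiv_val_prodComplex S.J
      J_snd := mfderiv_snd_prodComplex S.J
      xi_fst := mvfderiv_val_eulerVector
      xi_snd := mfderiv_snd_eulerVector }⟩

end IsSpecialKahlerPair

/-- The structure induced by the conification is unique. -/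
theorem ConInduces.same {T T' : ConicalAffineSpecialKahler (𝓘(ℝ, ℂ).prod I) (ℂˣ × M)}
    (hT' : ConInduces S p T') (hT : ConInduces S p T) : T'.Same T where
  J := fun q u => tangent_prod_ext (by rw [hT'.J_fst, hT.J_fst]) (by rw [hT'.J_snd, hT.J_snd])
  g := fun q u v => by rw [hT'.induces.metric, hT.induces.metric]
  xi := fun q => tangent_prod_ext (by rw [hT'.xi_fst, hT.xi_fst]) (by rw [hT'.xi_snd, hT.xi_snd])
  nabla := fun Y q u => by
    have h := hT.induces.immersion
    apply (h.isInvertible q).injective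
    rw [(connection_iff h.smooth Y q u _).1 (hT'.induces.connection Y q u),
      (connection_iff h.smooth Y q u _).1 (hT.induces.connection Y q u)]

end Conification

section RealSymplectic

variable {m : ℕ}

/-- Linear automorphisms of `ℂ^{2m}` induced by real symplectic ones. -/
structure IsRealSymplectic (L : CSymp m →ₗ[ℂ] CSymp m) : Prop where
  map_star : ∀ u, L (star u) = star (L u)
  sympForm_map : ∀ u v, sympForm (L u) (L v) = sympForm u v

theorem IsRealSymplectic.hermForm_map {L : CSymp m →ₗ[ℂ] CSymp m} (hL : IsRealSymplectic L)
    (u v : CSymp m) : hermForm (L u) (L v) = hermForm u v := by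
  rw [hermForm_eq, hermForm_eq, ← hL.map_star, hL.sympForm_map]

/-- The inclusion `ℝ^{2m} ⊂ ℂ^{2m}` as a continuous linear map. -/
def complexifyVecL (m : ℕ) : (Fin m ⊕ Fin m → ℝ) →L[ℝ] CSymp m :=
  ContinuousLinearMap.pi fun j => Complex.ofRealCLM ∘L ContinuousLinearMap.proj j

theorem star_complexifyVec (v : Fin m ⊕ Fin m → ℝ) :
    star (complexifyVec v) = complexifyVec v := by
  ext j
  simp [complexifyVec]

theorem complexifyVec_re_add_im (u : CSymp m) :
    complexifyVec (rePart m u) + Complex.I • complexifyVec (imPart m u) = u := by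
  ext j
  simp [complexifyVec, mul_comm Complex.I, Complex.re_add_im]

/-- The restriction of a real symplectic automorphism to `ℝ^{2m}`. -/
def realRestrict (L : CSymp m →ₗ[ℂ] CSymp m) :
    (Fin m ⊕ Fin m → ℝ) →L[ℝ] (Fin m ⊕ Fin m → ℝ) :=
  rePart m ∘L (L.toContinuousLinearMap.restrictScalars ℝ) ∘L complexifyVecL m

theorem IsRealSymplectic.rePart_map {L : CSymp m →ₗ[ℂ] CSymp m} (hL : IsRealSymplectic L)
    (u : CSymp m) : rePart m (L u) = realRestrict L (rePart m u) := by
  have h : imPart m (L (complexifyVec (imPart m u))) = 0 := by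
    ext j
    have := congrFun (hL.map_star (complexifyVec (imPart m u))) j
    rw [star_complexifyVec] at this
    exact Complex.conj_eq_iff_im.1 this.symm
  conv_lhs => rw [← complexifyVec_re_add_im u]
  rw [map_add, map_add, map_smul, rePart_I_smul, h, neg_zero, add_zero]
  rfl

end RealSymplectic

section AffineTransformation

variable {E : Type*} [NormedAddCommGroup E] [NormedSpace ℝ E] [FiniteDimensional ℝ E]
  {H : Type*} [TopologicalSpace H] {I : ModelWithCorners ℝ E H}
  {M : Type*} [TopologicalSpace M] [ChartedSpace H M] [IsManifold I ∞ M] {m : ℕ}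
  {L : CSymp m →ₗ[ℂ] CSymp m} {φ : M → CSymp m}

theorem contMDiff_affine (L : CSymp m →ₗ[ℂ] CSymp m) (c : CSymp m)
    (hφ : ContMDiff I 𝓘(ℝ, CSymp m) ∞ φ) :
    ContMDiff I 𝓘(ℝ, CSymp m) ∞ (fun x => L (φ x) + c) :=
  ((L.toContinuousLinearMap.restrictScalars ℝ).contMDiff.comp hφ).add contMDiff_const

theorem mvfderiv_affine (L : CSymp m →ₗ[ℂ] CSymp m) (c : CSymp m)
    (hφ : ContMDiff I 𝓘(ℝ, CSymp m) ∞ φ) (x : M) (u : TangentSpace I x) :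
    mvfderiv I (fun x => L (φ x) + c) x u = L (mvfderiv I φ x u) := by
  have hφ' := (hφ x).mdifferentiableAt (by simp)
  have h1 := mvfderiv_comp_differentiableAt
    (F := fun v => (L.toContinuousLinearMap.restrictScalars ℝ) v + c) (by fun_prop) hφ'
  refine (DFunLike.congr_fun h1 u).trans ?_
  rw [fderiv_add_const, ContinuousLinearMap.fderiv]
  rfl

theorem IsRealSymplectic.isKahlerianMap (hL : IsRealSymplectic L) (c : CSymp m)
    (hφ : ContMDiff I 𝓘(ℝ, CSymp m) ∞ φ) (h : IsKahlerianMap I φ) :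
    IsKahlerianMap I (fun x => L (φ x) + c) := by
  intro x u hu
  apply h x u
  intro v
  rw [← hL.hermForm_map, ← mvfderiv_affine L c hφ, ← mvfderiv_affine L c hφ]
  exact hu v

theorem IsRealSymplectic.inducesASK (hL : IsRealSymplectic L) (c : CSymp m)
    {S : AffineSpecialKahler I M} (h : InducesASK φ S) :
    InducesASK (fun x => L (φ x) + c) S := by
  have hφ := h.immersion.smooth
  have hφ' := contMDiff_affine L c hφ
  have hre : ∀ (x : M) (u : TangentSpace I x),
      mvfderiv I (reMap fun x => L (φ x) + c) x u =
        realRestrict L (mvfderiv I (reMap φ) x u) := by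
    intro x u
    rw [mvfderiv_reMap hφ', mvfderiv_affine L c hφ, hL.rePart_map, mvfderiv_reMap hφ]
  have hk := hL.isKahlerianMap c hφ h.immersion.kahlerian
  refine ⟨⟨h.immersion.dim, hφ', fun x u => ?_, fun x u v huv => ?_, fun x u v => ?_, hk⟩,
    fun x u v => ?_, fun Y x u => ?_⟩
  · rw [mvfderiv_affine L c hφ, mvfderiv_affine L c hφ, h.immersion.holomorphic, map_smul]
  · rw [← sub_eq_zero]
    apply hk x
    intro w
    rw [map_sub, sub_eq_zero.2 huv, hermForm_eq, sympForm_zero_left, mul_zero]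
  · rw [mvfderiv_affine L c hφ, mvfderiv_affine L c hφ, hL.sympForm_map, h.immersion.lagrangian]
  · rw [mvfderiv_affine L c hφ, mvfderiv_affine L c hφ, hL.hermForm_map, h.metric]
  · refine (connection_iff hφ' Y x u _).2 ?_
    have h1 : MDifferentiableAt I 𝓘(ℝ, Fin m ⊕ Fin m → ℝ)
        (fun y => mvfderiv I (reMap φ) y (Y y)) x :=
      mdifferentiableAt_mvfderiv_apply (contMDiff_reMap hφ) (Y.mdifferentiableAt_mk x)
    have h2 := DFunLike.congr_fun (mvfderiv_clm_comp (realRestrict L) h1) u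
    rw [hre, (connection_iff hφ Y x u _).1 (h.connection Y x u),
      funext fun y => hre y (Y y)]
    exact h2.symm

end AffineTransformation

section GroupAction

variable {n : ℕ}

theorem star_mulVec_complexifyMat (X : Matrix (Fin n ⊕ Fin n) (Fin n ⊕ Fin n) ℝ) (u : CSymp n) :
    (complexifyMat X).mulVec (star u) = star ((complexifyMat X).mulVec u) := by
  ext j
  simp [complexifyMat, Matrix.mulVec, dotProduct]

theorem isRealSymplectic_mulVecLin (x : SpHeis n) :
    IsRealSymplectic (complexifyMat x.X.1).mulVecLin where
  map_star := star_mulVec_complexifyMat x.X.1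
  sympForm_map := sympForm_mulVec (complexifyMat_mem x.X.2)

/-- `ℂ^2 × ℂ^{2n} ≃ ℂ^{2n+2}`. -/
def conVecEquiv (n : ℕ) : (ℂ × ℂ × CSymp n) ≃ₗ[ℂ] CSymp (n + 1) :=
  { conVec n with
    invFun := fun u => (u (Sum.inl 0), u (Sum.inr 0), Sum.elim (fun i => u (Sum.inl i.succ))
      fun i => u (Sum.inr i.succ))
    left_inv := fun t => by
      refine Prod.ext rfl (Prod.ext rfl ?_)
      ext j
      rcases j with j | j <;> rfl
    right_inv := fun u => by
      ext j
      rcases j with j | j <;> refine Fin.cases ?_ (fun i => ?_) j <;> rfl }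

theorem conVecEquiv_apply (t : ℂ × ℂ × CSymp n) : conVecEquiv n t = conVec n t := rfl

/-- The linear action of `Sp(ℝ^{2n}) ⋉ Heis_{2n+1}(ℝ)` on `ℂ^2 × ℂ^{2n}`. -/
def conAct (x : SpHeis n) : (ℂ × ℂ × CSymp n) →ₗ[ℂ] (ℂ × ℂ × CSymp n) where
  toFun t := (t.1, t.2.1 + sympForm ((complexifyMat x.X.1).mulVec t.2.2) (complexifyVec x.v)
    - 2 * (x.s : ℂ) * t.1, (complexifyMat x.X.1).mulVec t.2.2 + t.1 • complexifyVec x.v)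
  map_add' t t' := by
    refine Prod.ext rfl (Prod.ext ?_ ?_)
    · simp only [Prod.fst_add, Prod.snd_add, Matrix.mulVec_add, sympForm_add_left]
      ring
    · simp only [Prod.fst_add, Prod.snd_add, Matrix.mulVec_add, add_smul]
      abel
  map_smul' c t := by
    refine Prod.ext rfl (Prod.ext ?_ ?_)
    · simp only [Prod.smul_fst, Prod.smul_snd, Matrix.mulVec_smul, sympForm_smul_left,
        RingHom.id_apply, smul_eq_mul]
      ring
    · simp only [Prod.smul_fst, Prod.smul_snd, Matrix.mulVec_smul, smul_add, RingHom.id_apply,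
        smul_eq_mul, mul_smul]

/-- The linear action of `Sp(ℝ^{2n}) ⋉ Heis_{2n+1}(ℝ)` on `ℂ^{2n+2}`. -/
def conRep (x : SpHeis n) : CSymp (n + 1) →ₗ[ℂ] CSymp (n + 1) :=
  (conVecEquiv n).toLinearMap ∘ₗ conAct x ∘ₗ (conVecEquiv n).symm.toLinearMap

theorem conRep_conVec (x : SpHeis n) (t : ℂ × ℂ × CSymp n) :
    conRep x (conVec n t) = conVec n (conAct x t) := by
  rw [← conVecEquiv_apply, ← conVecEquiv_apply]
  simp [conRep]

theorem conAct_apply (x : SpHeis n) (a b : ℂ) (v : CSymp n) : conAct x (a, b, v) =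
    (a, b + sympForm ((complexifyMat x.X.1).mulVec v) (complexifyVec x.v) - 2 * (x.s : ℂ) * a,
      (complexifyMat x.X.1).mulVec v + a • complexifyVec x.v) := rfl

theorem isRealSymplectic_conRep (x : SpHeis n) : IsRealSymplectic (conRep x) where
  map_star u := by
    obtain ⟨⟨a, b, v⟩, rfl⟩ := (conVecEquiv n).surjective u
    rw [conVecEquiv_apply, star_conVec, conRep_conVec, conRep_conVec, conAct_apply, conAct_apply,
      star_conVec, star_mulVec_complexifyMat, star_add, star_smul, star_complexifyVec]
    have h := conj_sympForm ((complexifyMat x.X.1).mulVec v) (complexifyVec x.v)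
    rw [star_complexifyVec] at h
    rw [← h]
    simp
  sympForm_map u v := by
    obtain ⟨⟨a, b, v⟩, rfl⟩ := (conVecEquiv n).surjective u
    obtain ⟨⟨a', b', v'⟩, rfl⟩ := (conVecEquiv n).surjective ‹_›
    rw [conVecEquiv_apply, conVecEquiv_apply, conRep_conVec, conRep_conVec, conAct_apply,
      conAct_apply, sympForm_conVec, sympForm_conVec]
    simp only [sympForm_add_left, sympForm_add_right, sympForm_smul_left, sympForm_smul_right,
      sympForm_self, sympForm_mulVec (complexifyMat_mem x.X.2)]
    rw [sympForm_swap ((complexifyMat x.X.1).mulVec v') (complexifyVec x.v)]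
    ring

/-- The conification is equivariant. -/
theorem con_smul {M : Type*} (x : SpHeis n) (p : ImmersionPair M n) (q : ℂˣ × M) :
    (x • p).con q = conRep x (p.con q) := by
  have h1 : ∀ p : ImmersionPair M n, p.con q =
    (q.1 : ℂ) • conVec n (1, 2 * p.F q.2 - pairingZW (p.φ q.2), p.φ q.2) := fun _ => rfl
  rw [h1, h1, map_smul, conRep_conVec, conAct_apply]
  refine congrArg _ (congrArg _ (Prod.ext rfl (Prod.ext ?_ ?_)))
  · simp only [ImmersionPair.smul_def]
    have h2 : sympForm (ImmersionPair.affineAct x (p.φ q.2)) (complexifyVec x.v) =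
        sympForm ((complexifyMat x.X.1).mulVec (p.φ q.2)) (complexifyVec x.v) := by
      rw [ImmersionPair.affineAct, sympForm_add_left, sympForm_self, add_zero]
    rw [h2]
    ring
  · simp [ImmersionPair.smul_def, ImmersionPair.affineAct]

end GroupAction

section Invariance

variable {E : Type*} [NormedAddCommGroup E] [NormedSpace ℝ E] [FiniteDimensional ℝ E]
  {H : Type*} [TopologicalSpace H] {I : ModelWithCorners ℝ E H}
  {M : Type*} [TopologicalSpace M] [ChartedSpace H M] [IsManifold I ∞ M]
  {n : ℕ} {S : AffineSpecialKahler I M} {p : ImmersionPair M n}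

theorem sum_snd_mul_fst_eq (u v : CSymp n) : ∑ i, u (Sum.inr i) * v (Sum.inl i) =
    1 / 2 * fderiv ℝ pairingZW u v + 1 / 2 * sympForm v u := by
  rw [fderiv_pairingZW, sympForm, Finset.mul_sum, Finset.mul_sum, ← Finset.sum_add_distrib]
  exact Finset.sum_congr rfl fun i _ => by ring

theorem con_smul_eq (x : SpHeis n) (p : ImmersionPair M n) :
    (x • p).con = fun q => conRep x (p.con q) + 0 := by
  ext1 q
  rw [con_smul, add_zero]

theorem IsSpecialKahlerPair.smul (hp : IsSpecialKahlerPair S p) (x : SpHeis n) :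
    IsSpecialKahlerPair S (x • p) := by
  have hφ := hp.induces.immersion.smooth
  have hind : InducesASK (x • p).φ S :=
    (isRealSymplectic_mulVecLin x).inducesASK (complexifyVec x.v) hp.induces
  have hφ' := hind.immersion.smooth
  have hd : ∀ (y : M) (u : TangentSpace I y), mvfderiv I (x • p).φ y u =
      (complexifyMat x.X.1).mulVec (mvfderiv I p.φ y u) :=
    fun y u => mvfderiv_affine (complexifyMat x.X.1).mulVecLin (complexifyVec x.v) hφ y u
  let B : CSymp n →L[ℝ] ℂ := ({
      toFun := fun u => sympForm u (complexifyVec x.v)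
      map_add' := fun u v => sympForm_add_left u v _
      map_smul' := fun c u => sympForm_smul_left c u _ } :
        CSymp n →ₗ[ℂ] ℂ).toContinuousLinearMap.restrictScalars ℝ
  have hF : (x • p).F = fun y => (fun t : ℂ × CSymp n × CSymp n => t.1 - 1 / 2 * pairingZW t.2.1 +
      1 / 2 * pairingZW t.2.2 + 1 / 2 * B t.2.2 - (x.s : ℂ)) (p.F y, p.φ y, (x • p).φ y) := rfl
  have hG : ContDiff ℝ ∞ (fun t : ℂ × CSymp n × CSymp n => t.1 - 1 / 2 * pairingZW t.2.1 +
      1 / 2 * pairingZW t.2.2 + 1 / 2 * B t.2.2 - (x.s : ℂ)) := by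
    have := contDiff_pairingZW (n := n)
    fun_prop
  refine ⟨hind, ?_, fun y u => ?_⟩
  · rw [hF]
    exact hG.contMDiff.comp (hp.smooth.prodMk_space (hφ.prodMk_space hφ'))
  · have hF1 := (hp.smooth y).mdifferentiableAt (by simp)
    have h1 := (hφ y).mdifferentiableAt (by simp)
    have h2 := (hφ' y).mdifferentiableAt (by simp)
    have hP := contDiff_pairingZW.differentiable (n := ∞) (by simp) (𝕜 := ℝ) (E := CSymp n)
    have hGd : ∀ t s : ℂ × CSymp n × CSymp n, fderiv ℝ (fun t : ℂ × CSymp n × CSymp n =>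
        t.1 - 1 / 2 * pairingZW t.2.1 + 1 / 2 * pairingZW t.2.2 + 1 / 2 * B t.2.2 - (x.s : ℂ)) t s =
        s.1 - 1 / 2 * fderiv ℝ pairingZW t.2.1 s.2.1 + 1 / 2 * fderiv ℝ pairingZW t.2.2 s.2.2
          + 1 / 2 * B s.2.2 := by
      intro t s
      let pr : ℂ × CSymp n × CSymp n →L[ℝ] CSymp n × CSymp n := .snd ℝ ℂ (CSymp n × CSymp n)
      let pr₁ : ℂ × CSymp n × CSymp n →L[ℝ] CSymp n := (ContinuousLinearMap.fst ℝ (CSymp n) (CSymp n)).comp pr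
      let pr₂ : ℂ × CSymp n × CSymp n →L[ℝ] CSymp n := (ContinuousLinearMap.snd ℝ (CSymp n) (CSymp n)).comp pr
      have e1 := HasFDerivAt.comp (𝕜 := ℝ) (g := pairingZW) (f := fun t => pr₁ t) t
        (hP t.2.1).hasFDerivAt pr₁.hasFDerivAt
      have e2 := HasFDerivAt.comp (𝕜 := ℝ) (g := pairingZW) (f := fun t => pr₂ t) t
        (hP t.2.2).hasFDerivAt pr₂.hasFDerivAt
      have e3 := (B.comp pr₂).hasFDerivAt (x := t)
      have e := ((((hasFDerivAt_fst (𝕜 := ℝ) (p := t)).sub (e1.const_mul (1 / 2 : ℂ))).add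
        (e2.const_mul (1 / 2 : ℂ))).add (e3.const_mul (1 / 2 : ℂ))).sub_const (x.s : ℂ)
      exact DFunLike.congr_fun e.fderiv s
    have h3 := mvfderiv_comp_differentiableAt (hG.differentiable (by simp) _)
      (hF1.prodMk_space (h1.prodMk_space h2))
    rw [← hF, mvfderiv_prodMk hF1 (h1.prodMk_space h2), mvfderiv_prodMk h1 h2] at h3
    refine (DFunLike.congr_fun h3 u).trans ((hGd _ _).trans ?_)
    change mvfderiv I p.F y u - 1 / 2 * fderiv ℝ pairingZW (p.φ y) (mvfderiv I p.φ y u) +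
      1 / 2 * fderiv ℝ pairingZW ((x • p).φ y) (mvfderiv I (x • p).φ y u) +
      1 / 2 * sympForm (mvfderiv I (x • p).φ y u) (complexifyVec x.v) = _
    have h4 : sympForm (mvfderiv I (x • p).φ y u) ((x • p).φ y) =
        sympForm (mvfderiv I p.φ y u) (p.φ y) +
          sympForm (mvfderiv I (x • p).φ y u) (complexifyVec x.v) := by
      change sympForm _ ((complexifyMat x.X.1).mulVec (p.φ y) + complexifyVec x.v) = _
      rw [sympForm_add_right, hd, sympForm_mulVec (complexifyMat_mem x.X.2)]
    rw [hp.prepotential, sum_snd_mul_fst_eq, sum_snd_mul_fst_eq, h4]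
    ring

theorem ImmersionPair.IsNondegenerate.smul (hp : IsSpecialKahlerPair S p)
    (hnd : p.IsNondegenerate I) (x : SpHeis n) : (x • p).IsNondegenerate I where
  kahlerian := by
    rw [con_smul_eq]
    exact (isRealSymplectic_conRep x).isKahlerianMap 0 hp.contMDiff_con hnd.kahlerian
  hermForm_ne q := by
    rw [con_smul, (isRealSymplectic_conRep x).hermForm_map]
    exact hnd.hermForm_ne q

theorem ConInduces.smul {T : ConicalAffineSpecialKahler (𝓘(ℝ, ℂ).prod I) (ℂˣ × M)}
    (hT : ConInduces S p T) (x : SpHeis n) : ConInduces S (x • p) T where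
  induces := by
    rw [con_smul_eq]
    exact (isRealSymplectic_conRep x).inducesASK 0 hT.induces
  J_fst := hT.J_fst
  J_snd := hT.J_snd
  xi_fst := hT.xi_fst
  xi_snd := hT.xi_snd

end Invariance

end

theorem mainTheorem5 {n : ℕ} {M : Type*} [TopologicalSpace M] [T2Space M]
    [SecondCountableTopology M] [ChartedSpace (EuclideanSpace ℝ (Fin (2 * n))) M]
    [IsManifold 𝓘(ℝ, EuclideanSpace ℝ (Fin (2 * n))) ∞ M]
    (S : AffineSpecialKahler 𝓘(ℝ, EuclideanSpace ℝ (Fin (2 * n))) M)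
    (p : ImmersionPair M n) (hp : IsSpecialKahlerPair S p)
    (hnd : p.IsNondegenerate 𝓘(ℝ, EuclideanSpace ℝ (Fin (2 * n)))) :
    ∃ T : ConicalAffineSpecialKahler
        (𝓘(ℝ, ℂ).prod 𝓘(ℝ, EuclideanSpace ℝ (Fin (2 * n)))) (ℂˣ × M),
      ConInduces S p T ∧
      ∀ p' ∈ MulAction.orbit (SpHeis n) p,
        IsSpecialKahlerPair S p' ∧
        p'.IsNondegenerate 𝓘(ℝ, EuclideanSpace ℝ (Fin (2 * n))) ∧
        ConInduces S p' T ∧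
        ∀ T' : ConicalAffineSpecialKahler
            (𝓘(ℝ, ℂ).prod 𝓘(ℝ, EuclideanSpace ℝ (Fin (2 * n)))) (ℂˣ × M),
          ConInduces S p' T' → T'.Same T := by
  obtain ⟨T, hT⟩ := hp.exists_conInduces hnd
  refine ⟨T, hT, ?_⟩
  rintro _ ⟨x, rfl⟩
  exact ⟨hp.smul x, hnd.smul hp x, hT.smul x, fun T' hT' => hT'.same (hT.smul x)⟩
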